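/- **Raĭkov's Theorem.** Let $A$ be a Banach $*$-algebra, i.e. a complex algebra (not necessarily unital or commutative) with an involution $a \mapsto a^*$ (conjugate linear, $(ab)^* = b^*a^*$, $a^{**}=a$; no continuity is assumed) and a complete norm $|\cdot|$ such that $|ab| \le |a|\,|b|$ for all $a,b\in A$. *Notation.* A unit of $A$ is a non-zero two-sided identity element. Put $\widetilde A := A$ if $A$ has a unit, and otherwise let $\widetilde A := \mathbb{C}e \oplus A$ be the unitisation; the spectrum of $a\in A$ is $\operatorname{sp}(a) := \{\lambda\in\mathbb{C} : \lambda e - a \text{ is not invertible in } \widetilde A\}$. The algebra $A$ is called Hermitian if $\operatorname{sp}(a)\subset\mathbb{R}$ for every $a\in A$ with $a^*=a$. For $a\in A$ put $r_\lambda(a) := \inf_{n\ge 1} |a^n|^{1/n}$ and $r_\sigma(a) := r_\lambda(a^*a)^{1/2}$. A state on $A$ is a linear functional $\psi : A\to\mathbb{C}$ such that (a) $\psi(a^*a)\ge 0$ for all $a\in A$; (b) for each $b\in A$, the functional $a\mapsto\psi(b^*ab)$ is continuous on $A_{sa} := \{a\in A : a^*=a\}$; (c) $|\psi(a)|^2\le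 v\,\psi(a^*a)$ for all $a \in A$ and some $v\ge 0$, and the infimum of all such $v$ is $1$. Let $S(A)$ be the set of states on $A$. For $\psi\in S(A)$ let $H_\psi$ be the Hilbert space completion of the quotient of $A$ by the isotropic subspace of the positive semidefinite form $\langle a,b\rangle_\psi := \psi(b^*a)$, and let $\pi_\psi(a)$ be the bounded operator on $H_\psi$ extending the left translation by $a$ (the GNS representation of $\psi$). Let $\pi_u := \bigoplus_{\psi\in S(A)}\pi_\psi$, acting on the Hilbert space direct sum $H_u := \bigoplus_{\psi\in S(A)}H_\psi$, be the universal representation of $A$, and let $\|\pi_u(a)\|$ denote the operator norm of $\pi_u(a)$. For $a\in A$ let $\|a\|_o := \sup_{\psi\in S(A)}\psi(a^*a)^{1/2}$ (the Gelfand-Naĭmark seminorm), with $\|a\|_o := 0$ if $S(A)=\emptyset$. *Claim.* The following statements are equivalent: (i) $A$ is Hermitian; (ii) $\|\pi_u(a)\| = r_\sigma(a)$ for all $a\in A$; (iii) $\|a\|_o = r_\sigma(a)$ for all $a\in A$. -/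

import Mathlib

namespace BanachStar

open scoped ComplexOrder InnerProductSpace

set_option linter.unusedSectionVars false

noncomputable section

variable {A : Type*} [NonUnitalNormedRing A] [NormedSpace ℂ A] [IsScalarTower ℂ A A]
  [SMulCommClass ℂ A A] [StarRing A] [StarModule ℂ A]

/-! ### Spectrum, Hermitian algebras, the Pták function -/

/-- A unit of `A`: a non-zero two-sided identity element. -/
def IsUnitElement (e : A) : Prop :=
  e ≠ 0 ∧ ∀ a : A, e * a = a ∧ a * e = a

/-- The spectrum of `a`: the set of complex `z` such that `z e - a` is not invertible in the
unitisation of `A`, where the unitisation of an algebra with unit is the algebra itself, and the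
unitisation of an algebra without unit is `ℂ ⊕ A`. -/
def sp (a : A) : Set ℂ :=
  {z | (∃ e : A, IsUnitElement e ∧ ¬ ∃ b : A, (z • e - a) * b = e ∧ b * (z • e - a) = e) ∨
    ((¬ ∃ e : A, IsUnitElement e) ∧ z ∈ spectrum ℂ (a : Unitization ℂ A))}

variable (A) in
/-- A `*`-algebra is Hermitian if each of its self-adjoint elements has real spectrum. -/
def IsHermitianAlgebra : Prop :=
  ∀ a : A, IsSelfAdjoint a → ∀ z ∈ sp a, z.im = 0

/-- `powSucc a n` is the power `a ^ (n + 1)`. -/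
def powSucc (a : A) : ℕ → A
  | 0 => a
  | n + 1 => powSucc a n * a

/-- `r_λ(a) = inf_{n ≥ 1} ‖a ^ n‖ ^ (1 / n)`. -/
def rLambda (a : A) : ℝ :=
  ⨅ n : ℕ, ‖powSucc a n‖ ^ (1 / ((n : ℝ) + 1))

/-- The Pták function `r_σ(a) = r_λ(a* a) ^ (1 / 2)`. -/
def rSigma (a : A) : ℝ :=
  Real.sqrt (rLambda (star a * a))

/-! ### Positive functionals and states -/

/-- Positivity of a linear functional: `φ(a* a) ≥ 0` for all `a`. -/
def IsPositiveFunctional (φ : A →ₗ[ℂ] ℂ) : Prop :=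
  ∀ a : A, 0 ≤ φ (star a * a)

/-- For each `b`, the functional `a ↦ φ(b* a b)` is continuous on the self-adjoint part. -/
def IsWeaklyContinuousOnSA (φ : A →ₗ[ℂ] ℂ) : Prop :=
  ∀ b : A, ContinuousOn (fun a : A => φ (star b * a * b)) {a : A | IsSelfAdjoint a}

/-- The constants `v ≥ 0` with `|φ(a)|² ≤ v φ(a* a)` for all `a`. -/
def variationBounds (φ : A →ₗ[ℂ] ℂ) : Set ℝ :=
  {v | 0 ≤ v ∧ ∀ a : A, ‖φ a‖ ^ 2 ≤ v * (φ (star a * a)).re}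

/-- A state: a positive linear functional which is weakly continuous on the self-adjoint part and
has finite variation, equal to `1`. -/
structure IsState (ψ : A →ₗ[ℂ] ℂ) : Prop where
  positive : IsPositiveFunctional ψ
  weaklyContinuous : IsWeaklyContinuousOnSA ψ
  finiteVariation : (variationBounds ψ).Nonempty
  variation_eq_one : sInf (variationBounds ψ) = 1

variable (A) in
/-- The set `S(A)` of states, as a type. -/
abbrev State : Type _ := {ψ : A →ₗ[ℂ] ℂ // IsState ψ}

/-- The Gelfand-Naimark seminorm `‖a‖_o = sup_ψ ψ(a* a) ^ (1 / 2)`; the supremum over the empty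
family is `0`. -/
def gnSeminorm (a : A) : ℝ :=
  ⨆ ψ : State A, Real.sqrt (ψ.1 (star a * a)).re

/-! ### The GNS representation of a state -/

theorem IsPositiveFunctional.star_mul_conj {φ : A →ₗ[ℂ] ℂ} (h : IsPositiveFunctional φ) (a b : A) :
    starRingEnd ℂ (φ (star b * a)) = φ (star a * b) := by
  have e1 := (Complex.le_def.1 (h (a + b))).2
  have e2 := (Complex.le_def.1 (h (a + Complex.I • b))).2
  have ea := (Complex.le_def.1 (h a)).2
  have eb := (Complex.le_def.1 (h b)).2
  simp [add_mul, mul_add, smul_mul_assoc, mul_smul_comm, star_smul] at e1 e2 ea eb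
  apply Complex.ext
  · simp; linarith
  · simp; linarith

theorem IsPositiveFunctional.re_nonneg {φ : A →ₗ[ℂ] ℂ} (h : IsPositiveFunctional φ) (a : A) :
    0 ≤ (φ (star a * a)).re :=
  (Complex.le_def.1 (h a)).1

/-- The space `A` with the semi-inner product `(a, b) ↦ ψ(a* b)`, which is conjugate linear in the
first variable. -/
def PreGNS (_ψ : State A) : Type _ := A

namespace PreGNS

instance (ψ : State A) : AddCommGroup (PreGNS ψ) := inferInstanceAs (AddCommGroup A)
instance (ψ : State A) : Module ℂ (PreGNS ψ) := inferInstanceAs (Module ℂ A)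

/-- The identity map from `A` onto the underlying space of `PreGNS ψ`. -/
def of (ψ : State A) : A ≃ₗ[ℂ] PreGNS ψ := LinearEquiv.refl ℂ _

/-- The semi-inner product `(a, b) ↦ ψ(a* b)`. -/
abbrev core (ψ : State A) : PreInnerProductSpace.Core ℂ (PreGNS ψ) where
  inner a b := ψ.1 (star ((of ψ).symm a) * (of ψ).symm b)
  conj_inner_symm a b := ψ.2.positive.star_mul_conj _ _
  re_inner_nonneg a := ψ.2.positive.re_nonneg _
  add_left a b c := by rw [map_add, star_add, add_mul, map_add]
  smul_left a b r := by simp [smul_mul_assoc]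

instance (ψ : State A) : SeminormedAddCommGroup (PreGNS ψ) :=
  InnerProductSpace.Core.toSeminormedAddCommGroup (c := core ψ)

instance (ψ : State A) : InnerProductSpace ℂ (PreGNS ψ) :=
  InnerProductSpace.ofCore (core ψ)

theorem inner_def (ψ : State A) (a b : PreGNS ψ) :
    ⟪a, b⟫_ℂ = ψ.1 (star ((of ψ).symm a) * (of ψ).symm b) := rfl

theorem norm_sq (ψ : State A) (a : PreGNS ψ) :
    ‖a‖ ^ 2 = (ψ.1 (star ((of ψ).symm a) * (of ψ).symm a)).re := by
  rw [← inner_def, ← inner_self_eq_norm_sq (𝕜 := ℂ)]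
  rfl

end PreGNS

theorem tendsto_iterate_sq {x : A} (hx : ‖x‖ < 1) :
    Filter.Tendsto (fun n => (fun y : A => y * y)^[n] x) Filter.atTop (nhds 0) := by
  have hle : ∀ n, ‖(fun y : A => y * y)^[n] x‖ ≤ ‖x‖ ^ (2 ^ n) := by
    intro n
    induction n with
    | zero => simp
    | succ n ih =>
      rw [Function.iterate_succ_apply']
      calc _ ≤ ‖(fun y : A => y * y)^[n] x‖ * ‖(fun y : A => y * y)^[n] x‖ := norm_mul_le _ _
        _ ≤ ‖x‖ ^ (2 ^ n) * ‖x‖ ^ (2 ^ n) := by gcongr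
        _ = _ := by rw [← pow_add]; congr 1; ring
  refine squeeze_zero_norm hle ?_
  exact (tendsto_pow_atTop_nhds_zero_of_lt_one (norm_nonneg x) hx).comp
    (tendsto_pow_atTop_atTop_of_one_lt one_lt_two)

theorem IsState.conj_le_of_norm_lt_one (ψ : State A) (b x : A) (hx : IsSelfAdjoint x)
    (h1 : ‖x‖ < 1) : (ψ.1 (star b * x * b)).re ≤ (ψ.1 (star b * b)).re := by
  by_contra! hlt
  set P := (ψ.1 (star b * b)).re with hP
  have hP0 : 0 ≤ P := ψ.2.positive.re_nonneg b
  set y : ℕ → A := fun n => (fun y : A => y * y)^[n] x with hy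
  have hsa : ∀ n, IsSelfAdjoint (y n) := by
    intro n
    induction n with
    | zero => exact hx
    | succ n ih =>
      simp only [hy, Function.iterate_succ_apply'] at ih ⊢
      rw [IsSelfAdjoint, star_mul, ih.star_eq]
  have hstep : ∀ n, (ψ.1 (star b * y n * b)).re ^ 2 ≤ P * (ψ.1 (star b * y (n + 1) * b)).re := by
    intro n
    have hcs := norm_inner_le_norm (𝕜 := ℂ) (PreGNS.of ψ b) (PreGNS.of ψ (y n * b))
    have h2 : (ψ.1 (star b * y n * b)).re ^ 2 ≤
        (‖PreGNS.of ψ b‖ * ‖PreGNS.of ψ (y n * b)‖) ^ 2 := by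
      rw [PreGNS.inner_def] at hcs
      simp only [LinearEquiv.symm_apply_apply] at hcs
      rw [← mul_assoc] at hcs
      rw [sq_le_sq, abs_of_nonneg (by positivity : 0 ≤ ‖PreGNS.of ψ b‖ * _)]
      exact (Complex.abs_re_le_norm _).trans hcs
    rw [mul_pow, PreGNS.norm_sq, PreGNS.norm_sq] at h2
    simp only [LinearEquiv.symm_apply_apply, star_mul, (hsa n).star_eq] at h2
    have h3 : star b * y (n + 1) * b = star b * y n * (y n * b) := by
      simp only [hy, Function.iterate_succ_apply', mul_assoc]
    rw [h3]
    exact h2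
  have hgt : ∀ n, P < (ψ.1 (star b * y n * b)).re := by
    intro n
    induction n with
    | zero => exact hlt
    | succ n ih =>
      have := hstep n
      rcases hP0.eq_or_lt with h0 | h0
      · rw [← h0] at this ih
        nlinarith
      · by_contra! hle
        nlinarith
  have hlim : Filter.Tendsto (fun n => (ψ.1 (star b * y n * b)).re) Filter.atTop (nhds 0) := by
    have hc := (ψ.2.weaklyContinuous b) 0 (IsSelfAdjoint.zero A)
    have ht : Filter.Tendsto y Filter.atTop (nhdsWithin 0 {a : A | IsSelfAdjoint a}) :=
      tendsto_nhdsWithin_iff.2 ⟨tendsto_iterate_sq h1, Filter.Eventually.of_forall hsa⟩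
    have := Complex.continuous_re.continuousAt.tendsto.comp (hc.tendsto.comp ht)
    simpa [Function.comp_def] using this
  have hPle : P ≤ 0 := ge_of_tendsto' hlim fun n => (hgt n).le
  have hPz : P = 0 := le_antisymm hPle hP0
  have := hstep 0
  have h0 := hgt 0
  rw [hPz] at this h0
  nlinarith

/-- Left multiplication by `a` is bounded for the semi-inner product, uniformly in the state. -/
theorem PreGNS.norm_mul_le (ψ : State A) (a b : A) :
    ‖PreGNS.of ψ (a * b)‖ ≤ Real.sqrt (‖star a * a‖ + 1) * ‖PreGNS.of ψ b‖ := by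
  set c : ℝ := ‖star a * a‖ + 1 with hc
  have hc0 : 0 < c := by positivity
  have key := IsState.conj_le_of_norm_lt_one ψ b (((c⁻¹ : ℝ) : ℂ) • (star a * a))
    (by
      rw [IsSelfAdjoint, star_smul, star_mul, star_star]
      simp)
    (by
      rw [norm_smul, Complex.norm_real, Real.norm_of_nonneg (inv_nonneg.2 hc0.le),
        inv_mul_lt_iff₀ hc0]
      linarith)
  rw [mul_smul_comm, smul_mul_assoc, map_smul, smul_eq_mul, Complex.re_ofReal_mul,
    inv_mul_le_iff₀ hc0] at key
  rw [← sq_le_sq₀ (by positivity) (by positivity), mul_pow, Real.sq_sqrt hc0.le, norm_sq, norm_sq]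
  simp only [LinearEquiv.symm_apply_apply, star_mul]
  rw [show star b * star a * (a * b) = star b * (star a * a) * b by simp only [mul_assoc]]
  exact key

/-- Left multiplication by `a` on the semi-inner product space of `ψ`. -/
def PreGNS.leftMul (ψ : State A) (a : A) : PreGNS ψ →L[ℂ] PreGNS ψ :=
  ((PreGNS.of ψ).toLinearMap ∘ₗ LinearMap.mulLeft ℂ a ∘ₗ (PreGNS.of ψ).symm.toLinearMap).mkContinuous
    (Real.sqrt (‖star a * a‖ + 1)) fun x => PreGNS.norm_mul_le ψ a ((PreGNS.of ψ).symm x)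

theorem PreGNS.leftMul_apply (ψ : State A) (a : A) (x : PreGNS ψ) :
    PreGNS.leftMul ψ a x = PreGNS.of ψ (a * (PreGNS.of ψ).symm x) := rfl

/-- The GNS Hilbert space `H_ψ`: the Hausdorff completion of `A` for the semi-inner product of `ψ`,
that is, the completion of the quotient of `A` by the isotropic subspace. -/
abbrev GNS (ψ : State A) : Type _ := UniformSpace.Completion (PreGNS ψ)

/-- The operator `π_ψ(a)` of the GNS representation: the continuous extension of `b ↦ a b`. -/
def gnsOp (ψ : State A) (a : A) : GNS ψ →L[ℂ] GNS ψ := (PreGNS.leftMul ψ a).completion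

theorem gnsOp_coe (ψ : State A) (a : A) (x : PreGNS ψ) :
    gnsOp ψ a (x : GNS ψ) = ((PreGNS.of ψ (a * (PreGNS.of ψ).symm x) : PreGNS ψ) : GNS ψ) := by
  simp [gnsOp, PreGNS.leftMul_apply]

theorem gnsOp_norm_le (ψ : State A) (a : A) (x : GNS ψ) :
    ‖gnsOp ψ a x‖ ≤ Real.sqrt (‖star a * a‖ + 1) * ‖x‖ := by
  induction x using UniformSpace.Completion.induction_on with
  | hp => exact isClosed_le (by fun_prop) (by fun_prop)
  | ih x =>
    rw [gnsOp_coe, UniformSpace.Completion.norm_coe, UniformSpace.Completion.norm_coe]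
    exact PreGNS.norm_mul_le ψ a ((PreGNS.of ψ).symm x)

theorem gns_ext {ψ : State A} {S T : GNS ψ →L[ℂ] GNS ψ}
    (h : ∀ x : A, S (PreGNS.of ψ x : GNS ψ) = T (PreGNS.of ψ x : GNS ψ)) : S = T := by
  ext x
  induction x using UniformSpace.Completion.induction_on with
  | hp => exact isClosed_eq S.continuous T.continuous
  | ih x => exact h ((PreGNS.of ψ).symm x)

theorem gnsOp_of (ψ : State A) (a x : A) :
    gnsOp ψ a (PreGNS.of ψ x : GNS ψ) = (PreGNS.of ψ (a * x) : GNS ψ) := by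
  rw [gnsOp_coe, LinearEquiv.symm_apply_apply]

theorem gnsOp_smul (ψ : State A) (c : ℂ) (a : A) : gnsOp ψ (c • a) = c • gnsOp ψ a := by
  refine gns_ext fun x => ?_
  rw [smul_apply, gnsOp_of, gnsOp_of, smul_mul_assoc, map_smul,
    UniformSpace.Completion.coe_smul]

theorem gnsOp_add (ψ : State A) (a b : A) : gnsOp ψ (a + b) = gnsOp ψ a + gnsOp ψ b := by
  refine gns_ext fun x => ?_
  rw [add_apply, gnsOp_of, gnsOp_of, gnsOp_of, add_mul, map_add,
    UniformSpace.Completion.coe_add]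

theorem gnsOp_mul (ψ : State A) (a b : A) : gnsOp ψ (a * b) = gnsOp ψ a * gnsOp ψ b := by
  refine gns_ext fun x => ?_
  rw [mul_apply_eq_comp, gnsOp_of, gnsOp_of, gnsOp_of, mul_assoc]

theorem gnsOp_star_inner (ψ : State A) (a : A) (x y : GNS ψ) :
    ⟪gnsOp ψ (star a) x, y⟫_ℂ = ⟪x, gnsOp ψ a y⟫_ℂ := by
  induction x, y using UniformSpace.Completion.induction_on₂ with
  | hp =>
    exact isClosed_eq (((gnsOp ψ (star a)).continuous.comp continuous_fst).inner continuous_snd)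
      (continuous_fst.inner ((gnsOp ψ a).continuous.comp continuous_snd))
  | ih x y =>
    rw [gnsOp_coe, gnsOp_coe, UniformSpace.Completion.inner_coe, UniformSpace.Completion.inner_coe,
      PreGNS.inner_def, PreGNS.inner_def, LinearEquiv.symm_apply_apply,
      LinearEquiv.symm_apply_apply, star_mul, star_star, mul_assoc]

/-- The GNS representation `π_ψ` of a state. -/
def gnsRep (ψ : State A) : A →⋆ₙₐ[ℂ] (GNS ψ →L[ℂ] GNS ψ) where
  toFun := gnsOp ψ
  map_smul' := gnsOp_smul ψ
  map_zero' := by simpa using gnsOp_smul ψ 0 0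
  map_add' := gnsOp_add ψ
  map_mul' := gnsOp_mul ψ
  map_star' a := (ContinuousLinearMap.eq_adjoint_iff _ _).mpr (gnsOp_star_inner ψ a)

/-! ### The universal representation -/

variable (A) in
/-- The universal Hilbert space: the Hilbert space direct sum of the GNS spaces of all states. -/
abbrev UniversalSpace : Type _ := lp (fun ψ : State A => GNS ψ) 2

theorem memlp_gnsRep (a : A) (x : UniversalSpace A) :
    Memℓp (fun ψ : State A => gnsRep ψ a (x ψ)) 2 := by
  refine memℓp_gen ?_
  have hx := (lp.memℓp x).summable (p := 2) (by norm_num)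
  refine Summable.of_nonneg_of_le (fun ψ => by positivity) (fun ψ => ?_)
    (hx.mul_left ((Real.sqrt (‖star a * a‖ + 1)) ^ (2 : ENNReal).toReal))
  rw [← Real.mul_rpow (by positivity) (by positivity)]
  exact Real.rpow_le_rpow (by positivity) (gnsOp_norm_le ψ a (x ψ)) (by positivity)

/-- The direct sum over all states `ψ` of the operators `π_ψ(a)`. -/
def universalOp (a : A) : UniversalSpace A →L[ℂ] UniversalSpace A :=
  LinearMap.mkContinuous
    { toFun := fun x => ⟨fun ψ => gnsRep ψ a (x ψ), memlp_gnsRep a x⟩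
      map_add' := fun x y => by
        ext ψ
        exact map_add (gnsRep ψ a) (x ψ) (y ψ)
      map_smul' := fun c x => by
        ext ψ
        exact map_smul (gnsRep ψ a) c (x ψ) }
    (Real.sqrt (‖star a * a‖ + 1)) fun x => by
      refine lp.norm_le_of_forall_sum_le (by norm_num) (by positivity) fun s => ?_
      rw [Real.mul_rpow (by positivity) (by positivity)]
      refine le_trans (Finset.sum_le_sum fun ψ _ => Real.rpow_le_rpow (by positivity)
        (gnsOp_norm_le ψ a (x ψ)) (by positivity)) ?_
      simp only [Real.mul_rpow (Real.sqrt_nonneg _) (norm_nonneg _)]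
      rw [← Finset.mul_sum]
      exact mul_le_mul_of_nonneg_left (lp.sum_rpow_le_norm_rpow (by norm_num) x s) (by positivity)

theorem universalOp_apply (a : A) (x : UniversalSpace A) (ψ : State A) :
    universalOp a x ψ = gnsRep ψ a (x ψ) := rfl

variable (A) in
/-- The universal representation `π_u`, the direct sum of the GNS representations of all states. -/
def universalRep : A →⋆ₙₐ[ℂ] (UniversalSpace A →L[ℂ] UniversalSpace A) where
  toFun := universalOp
  map_smul' c a := by
    ext x ψ
    exact congrArg (fun T : GNS ψ →L[ℂ] GNS ψ => T (x ψ)) (map_smul (gnsRep ψ) c a)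
  map_zero' := by
    ext x ψ
    exact congrArg (fun T : GNS ψ →L[ℂ] GNS ψ => T (x ψ)) (map_zero (gnsRep ψ))
  map_add' a b := by
    ext x ψ
    exact congrArg (fun T : GNS ψ →L[ℂ] GNS ψ => T (x ψ)) (map_add (gnsRep ψ) a b)
  map_mul' a b := by
    ext x ψ
    exact congrArg (fun T : GNS ψ →L[ℂ] GNS ψ => T (x ψ)) (map_mul (gnsRep ψ) a b)
  map_star' a := by
    refine (ContinuousLinearMap.eq_adjoint_iff _ _).mpr fun x y => ?_
    rw [lp.inner_eq_tsum, lp.inner_eq_tsum]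
    refine tsum_congr fun ψ => ?_
    rw [universalOp_apply, universalOp_apply, map_star, ContinuousLinearMap.star_eq_adjoint,
      ContinuousLinearMap.adjoint_inner_left]

end

end BanachStar

namespace BanachStar

open Polynomial Filter Topology

set_option linter.unusedSectionVars false

/-! ### Spectral radius estimates and square roots in a unital Banach algebra. -/

section Banach

variable {B : Type*} [NormedRing B] [NormedAlgebra ℂ B] [CompleteSpace B]

/-! Two facts hold in every Banach *-algebra. First, `‖π_u(a)‖ = ‖a‖_o`, which makes (ii) and (iii)
equivalent. Each state is given by a cyclic vector of norm at most 1, so `‖a‖_o ≤ ‖π_u(a)‖`.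
Conversely, unit vectors coming from `A` are dense in the unit sphere of `H_ψ`, and their vector
states are again states of variation exactly 1. Second, `‖π_u(a)‖ ≤ r_σ(a)`, by the C*-identity and
because the spectrum shrinks under homomorphisms.

For (i) ⇒ (iii) it remains to find a state with value `r_λ(a* a)` at `a* a`. Work in the ℓ¹
unitization, which is again Hermitian. Ford's square root lemma gives Pták's inequality `r(a)² ≤
r(a* a)`. Hence `r(hk) ≤ r(h) r(k)` for self-adjoint `h`, `k`, sums of self-adjoint elements with
nonnegative spectrum have nonnegative spectrum, and so does each `a* a` (Shirali-Ford). The supremum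
of the spectrum is then sublinear on the self-adjoint part, and Hahn-Banach yields a functional
attaining it at `a* a`, which restricts to the required state.

For (ii) ⇒ (i), the hypothesis bounds each spectral value of a self-adjoint `x` by `‖π_u(x)‖`. A
non-real spectral value would put `i` in the spectrum of some self-adjoint `k`. The elements `k (1 -
c k²)^m` have bounded images under `π_u` for small `c > 0`, but their spectra contain `i (1 + c)^m`,
which is unbounded. -/

theorem exists_norm_pow_le_of_spectrum_lt [Nontrivial B] {a : B} {θ : ℝ}
    (h : ∀ z ∈ spectrum ℂ a, ‖z‖ < θ) : ∃ M : ℝ, 0 ≤ M ∧ ∀ n : ℕ, ‖a ^ n‖ ≤ M * θ ^ n := by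
  obtain ⟨z, hz⟩ := spectrum.nonempty a
  have hθ : 0 < θ := (norm_nonneg z).trans_lt (h z hz)
  lift θ to NNReal using hθ.le
  have hr : spectralRadius ℂ a < θ := spectrum.spectralRadius_lt_of_forall_lt a fun z hz => h z hz
  have hev := (spectrum.pow_nnnorm_pow_one_div_tendsto_nhds_spectralRadius a).eventually_lt_const hr
  have hle : ∀ᶠ n : ℕ in atTop, ‖a ^ n‖ ≤ 1 * ‖(θ : ℝ) ^ n‖ := by
    filter_upwards [hev, eventually_gt_atTop 0] with n hn h0
    have h0' : (0 : ℝ) < n := by exact_mod_cast h0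
    have h1 : (‖a ^ n‖₊ : ENNReal) ≤ (θ : ENNReal) ^ (n : ℝ) := by
      have := ENNReal.rpow_le_rpow hn.le h0'.le
      rwa [← ENNReal.rpow_mul, one_div_mul_cancel h0'.ne', ENNReal.rpow_one] at this
    rw [ENNReal.rpow_natCast] at h1
    have h2 : ‖a ^ n‖₊ ≤ θ ^ n := by exact_mod_cast h1
    rw [one_mul, Real.norm_of_nonneg (by positivity)]
    exact_mod_cast h2
  have hO : (fun n : ℕ => a ^ n) =O[atTop] fun n : ℕ => (θ : ℝ) ^ n :=
    Asymptotics.IsBigO.of_bound 1 hle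
  rw [Asymptotics.isBigO_nat_atTop_iff fun n hn => absurd hn (pow_pos hθ n).ne'] at hO
  obtain ⟨M, hM⟩ := hO
  refine ⟨max M 0, le_max_right _ _, fun n => (hM n).trans ?_⟩
  rw [Real.norm_of_nonneg (by positivity)]
  gcongr
  exact le_max_left _ _

/-- If `‖z‖ > θ`, then `‖z‖ ^ n ≤ ‖a ^ n‖ ‖1‖` contradicts the growth bound for large `n`. Together
with its converse above, this replaces characters of commutative subalgebras: growth bounds pass
easily to sums, products and limits. -/
theorem norm_le_of_mem_spectrum_of_norm_pow_le {a : B} {θ M : ℝ} (hθ : 0 ≤ θ)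
    (h : ∀ n : ℕ, ‖a ^ n‖ ≤ M * θ ^ n) {z : ℂ} (hz : z ∈ spectrum ℂ a) : ‖z‖ ≤ θ := by
  by_contra! hlt
  have hb : ∀ n : ℕ, ‖z‖ ^ n ≤ M * ‖(1 : B)‖ * θ ^ n := fun n => by
    have h1 := spectrum.norm_le_norm_mul_of_mem (spectrum.pow_mem_pow a n hz)
    rw [norm_pow] at h1
    calc _ ≤ _ := h1
      _ ≤ (M * θ ^ n) * ‖(1 : B)‖ := by gcongr; exact h n
      _ = _ := by ring
  have hz0 : 0 < ‖z‖ := hθ.trans_lt hlt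
  have hlim : Tendsto (fun n : ℕ => M * ‖(1 : B)‖ * (θ / ‖z‖) ^ n) atTop (𝓝 (M * ‖(1 : B)‖ * 0)) :=
    (tendsto_pow_atTop_nhds_zero_of_lt_one (by positivity) ((div_lt_one hz0).2 hlt)).const_mul _
  have : (1 : ℝ) ≤ M * ‖(1 : B)‖ * 0 := ge_of_tendsto' hlim fun n => by
    rw [div_pow, ← mul_div_assoc, le_div_iff₀ (pow_pos hz0 n), one_mul]
    exact hb n
  norm_num at this

theorem exists_spectrum_lt_lt [Nontrivial B] {x : B} {c : ℝ} (hc : 0 < c)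
    (hx : ∀ z ∈ spectrum ℂ x, ‖z‖ < c) : ∃ ρ < c, 0 ≤ ρ ∧ ∀ z ∈ spectrum ℂ x, ‖z‖ < ρ := by
  obtain ⟨z, hz, hr⟩ := spectrum.exists_nnnorm_eq_spectralRadius x
  refine ⟨(‖z‖ + c) / 2, by linarith [hx z hz], by positivity, fun w hw => ?_⟩
  have : (‖w‖₊ : ENNReal) ≤ ‖z‖₊ := by
    rw [hr]; exact le_iSup₂ (f := fun (k : ℂ) (_ : k ∈ spectrum ℂ x) => (‖k‖₊ : ENNReal)) w hw
  have : ‖w‖ ≤ ‖z‖ := by exact_mod_cast this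
  linarith [hx z hz]

theorem isUnit_one_sub_of_spectrum_lt {a : B} (h : ∀ z ∈ spectrum ℂ a, ‖z‖ < 1) :
    IsUnit (1 - a) := by
  by_contra hn
  have : (1 : ℂ) ∈ spectrum ℂ a := by rwa [spectrum.mem_iff, map_one]
  simpa using h 1 this

/-- The binomial theorem bounds `‖(a + b) ^ n‖` by a constant times `(2 θ) ^ n`. -/
theorem norm_le_of_mem_spectrum_add_of_commute [Nontrivial B] {a b : B} (hab : Commute a b)
    {θ : ℝ} (ha : ∀ z ∈ spectrum ℂ a, ‖z‖ < θ) (hb : ∀ z ∈ spectrum ℂ b, ‖z‖ < θ) {z : ℂ}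
    (hz : z ∈ spectrum ℂ (a + b)) : ‖z‖ ≤ 2 * θ := by
  obtain ⟨w, hw⟩ := spectrum.nonempty a
  have hθ : 0 < θ := (norm_nonneg w).trans_lt (ha w hw)
  obtain ⟨M, hM0, hM⟩ := exists_norm_pow_le_of_spectrum_lt ha
  obtain ⟨N, hN0, hN⟩ := exists_norm_pow_le_of_spectrum_lt hb
  refine norm_le_of_mem_spectrum_of_norm_pow_le (M := M * N) (by positivity) (fun n => ?_) hz
  have hb : ∀ m ∈ Finset.range (n + 1), ‖a ^ m * b ^ (n - m) * (n.choose m : B)‖ ≤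
      M * N * θ ^ n * n.choose m := fun m hm => by
    have hm' : m + (n - m) = n := by have := Finset.mem_range.1 hm; omega
    rw [← nsmul_eq_mul']
    calc _ ≤ n.choose m * ‖a ^ m * b ^ (n - m)‖ := norm_nsmul_le
      _ ≤ n.choose m * ((M * θ ^ m) * (N * θ ^ (n - m))) := by
        gcongr
        refine (norm_mul_le _ _).trans ?_
        gcongr
        · exact hM m
        · exact hN _
      _ = n.choose m * (M * N * θ ^ (m + (n - m))) := by rw [pow_add]; ring
      _ = _ := by rw [hm']; ring
  rw [hab.add_pow]
  refine (norm_sum_le_of_le _ hb).trans (le_of_eq ?_)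
  rw [← Finset.mul_sum]
  have : ∑ m ∈ Finset.range (n + 1), (n.choose m : ℝ) = 2 ^ n := by
    exact_mod_cast Nat.sum_range_choose n
  rw [this, mul_pow]
  ring

/-! ### Square roots -/

/-- The polynomial approximations to the solution `y` of `y = x + y ^ 2`. -/
noncomputable def sqrtIter : ℕ → ℕ[X]
  | 0 => 0
  | n + 1 => X + sqrtIter n ^ 2

/-- The successive differences of `sqrtIter`. -/
noncomputable def sqrtIncr : ℕ → ℕ[X]
  | 0 => X
  | n + 1 => sqrtIncr n * (sqrtIter (n + 1) + sqrtIter n)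

/-- Difference of two squares, written without subtraction: coefficients in ℕ let values at `x` be
majorized by values at a real number. -/
theorem sqrtIter_succ_eq_add (n : ℕ) : sqrtIter (n + 1) = sqrtIter n + sqrtIncr n := by
  induction n with
  | zero => simp [sqrtIter, sqrtIncr]
  | succ n ih =>
    have h : sqrtIter (n + 2) = X + sqrtIter (n + 1) ^ 2 := rfl
    have h' : sqrtIter (n + 1) = X + sqrtIter n ^ 2 := rfl
    rw [h, sqrtIncr]
    conv_rhs => lhs; rw [h']
    rw [ih]
    ring

theorem aeval_nonneg (p : ℕ[X]) {ρ : ℝ} (hρ : 0 ≤ ρ) : 0 ≤ aeval ρ p := by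
  rw [aeval_eq_sum_range]
  exact Finset.sum_nonneg fun i _ => by positivity

/-- The bound is preserved because `(ρ + 1/4)² ≤ 1/4`. For `ρ < 1/4` it stays below `1/2`, so that
the increments decay geometrically. -/
theorem aeval_sqrtIter_le {ρ : ℝ} (h0 : 0 ≤ ρ) (h1 : ρ ≤ 1 / 4) (n : ℕ) :
    aeval ρ (sqrtIter n) ≤ ρ + 1 / 4 := by
  induction n with
  | zero => simp [sqrtIter]; linarith
  | succ n ih =>
    have := aeval_nonneg (sqrtIter n) h0
    simp only [sqrtIter, map_add, map_pow, aeval_X]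
    nlinarith

theorem aeval_sqrtIncr_le {ρ : ℝ} (h0 : 0 ≤ ρ) (h1 : ρ ≤ 1 / 4) (n : ℕ) :
    aeval ρ (sqrtIncr n) ≤ ρ * (2 * (ρ + 1 / 4)) ^ n := by
  induction n with
  | zero => simp [sqrtIncr]
  | succ n ih =>
    simp only [sqrtIncr, map_add, map_mul]
    rw [pow_succ, ← mul_assoc]
    have h2 := aeval_nonneg (sqrtIter n) h0
    have h3 := aeval_nonneg (sqrtIter (n + 1)) h0
    gcongr
    linarith [aeval_sqrtIter_le h0 h1 n, aeval_sqrtIter_le h0 h1 (n + 1)]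

theorem norm_aeval_le {x : B} {M ρ : ℝ} (hx : ∀ n : ℕ, ‖x ^ n‖ ≤ M * ρ ^ n) (p : ℕ[X]) :
    ‖aeval x p‖ ≤ M * aeval ρ p := by
  rw [aeval_eq_sum_range, aeval_eq_sum_range, Finset.mul_sum]
  refine norm_sum_le_of_le _ fun i _ => ?_
  calc _ ≤ (p.coeff i : ℝ) * ‖x ^ i‖ := norm_nsmul_le
    _ ≤ p.coeff i * (M * ρ ^ i) := by gcongr; exact hx i
    _ = _ := by rw [nsmul_eq_mul]; ring

/-- If the spectral radius of `x` is less than `1 / 4`, then `y = x + y ^ 2` has a solution of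
spectral radius less than `1 / 2` which is a limit of polynomials in `x`. -/
theorem exists_eq_add_sq [Nontrivial B] {x : B} (hx : ∀ z ∈ spectrum ℂ x, ‖z‖ < 1 / 4) :
    ∃ y : B, y = x + y ^ 2 ∧ (∃ θ < 1 / 2, ∀ z ∈ spectrum ℂ y, ‖z‖ ≤ θ) ∧
      ∀ w, Commute x w → Commute y w := by
  obtain ⟨ρ, h1, h0, hρ⟩ := exists_spectrum_lt_lt (by norm_num) hx
  obtain ⟨M, hM0, hM⟩ := exists_norm_pow_le_of_spectrum_lt hρ
  set u : ℕ → B := fun n => aeval x (sqrtIter n) with hu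
  have hdist : ∀ n, dist (u n) (u (n + 1)) ≤ (M * ρ) * (2 * (ρ + 1 / 4)) ^ n := fun n => by
    rw [dist_comm, dist_eq_norm]
    simp only [hu, sqrtIter_succ_eq_add, map_add, add_sub_cancel_left]
    refine (norm_aeval_le hM _).trans ?_
    rw [mul_assoc]
    gcongr
    exact aeval_sqrtIncr_le h0 h1.le n
  obtain ⟨y, hy⟩ := cauchySeq_tendsto_of_complete
    (cauchySeq_of_le_geometric _ _ (by linarith) hdist)
  have hsucc : ∀ n, u (n + 1) = x + u n ^ 2 := fun n => by simp [hu, sqrtIter]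
  refine ⟨y, ?_, ⟨ρ + 1 / 4, by linarith, fun z hz => ?_⟩, fun w hw => ?_⟩
  · refine tendsto_nhds_unique (hy.comp (tendsto_add_atTop_nat 1)) ?_
    simp only [Function.comp_def, hsucc]
    exact (hy.pow 2).const_add x
  -- Applying the majorant to the `m`-th power of the polynomial gives the same constant `M` for all
  -- `m`, hence a spectral bound for the limit.
  · refine norm_le_of_mem_spectrum_of_norm_pow_le (M := M) (by positivity) (fun m => ?_) hz
    refine le_of_tendsto' (hy.pow m).norm fun n => ?_
    simp only [hu, ← map_pow]
    refine (norm_aeval_le hM _).trans ?_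
    rw [map_pow]
    gcongr
    · exact aeval_nonneg _ h0
    · exact aeval_sqrtIter_le h0 h1.le n
  · have hc : ∀ n, Commute (u n) w := fun n => by
      induction n with
      | zero => simp [hu, sqrtIter]
      | succ n ih => rw [hsucc]; exact hw.add_left (ih.pow_left 2)
    exact tendsto_nhds_unique (hy.mul_const w) (by simpa only [(hc _).eq] using hy.const_mul w)

variable [StarRing B] [StarModule ℂ B]

/-- Ford's square root lemma; the involution need not be continuous. -/
theorem exists_isSelfAdjoint_sq_eq_one_sub [Nontrivial B] {x : B} (hsa : IsSelfAdjoint x)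
    (hx : ∀ z ∈ spectrum ℂ x, ‖z‖ < 1) : ∃ s : B, IsSelfAdjoint s ∧ s * s = 1 - x := by
  have hx' : ∀ z ∈ spectrum ℂ ((1 / 4 : ℂ) • x), ‖z‖ < 1 / 4 := fun z hz => by
    rw [spectrum.smul_eq_smul _ _ (spectrum.nonempty x)] at hz
    obtain ⟨w, hw, rfl⟩ := hz
    have := hx w hw
    simp only [norm_smul]
    norm_num
    linarith
  obtain ⟨y, hy, ⟨θ, hθ, hyθ⟩, hcomm⟩ := exists_eq_add_sq hx'
  set x' := (1 / 4 : ℂ) • x with hx'def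
  have hsa' : IsSelfAdjoint x' := by
    rw [IsSelfAdjoint, hx'def, star_smul, hsa.star_eq]; simp
  -- The involution may be discontinuous, so `star y = y` cannot be obtained by passing to the
  -- limit. Instead, `star y` solves the same equation and commutes with `y`.
  have hsy : star y = x' + star y ^ 2 := by
    conv_lhs => rw [hy]
    rw [star_add, star_pow, hsa'.star_eq]
  have hxy : Commute x' (star y) := by
    have := (hcomm x' (Commute.refl x')).symm.star_star
    rwa [hsa'.star_eq] at this
  have hc : Commute y (star y) := hcomm _ hxy
  have hθ' : ∀ z ∈ spectrum ℂ y, ‖z‖ < (θ + 1 / 2) / 2 := fun z hz => by linarith [hyθ z hz]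
  have hsθ' : ∀ z ∈ spectrum ℂ (star y), ‖z‖ < (θ + 1 / 2) / 2 := fun z hz => by
    rw [spectrum.map_star, Set.mem_star] at hz
    simpa using hθ' _ hz
  have hu : IsUnit (1 - (y + star y)) := isUnit_one_sub_of_spectrum_lt fun z hz => by
    linarith [norm_le_of_mem_spectrum_add_of_commute hc hθ' hsθ' hz]
  -- Subtracting the two equations gives `y - y* = (y - y*)(y + y*)`; the factor `1 - (y + y*)` is
  -- invertible since both spectral radii are below `1/2`.
  have hzero : (y - star y) * (1 - (y + star y)) = 0 := by
    have h1 : (y - star y) * (1 - (y + star y)) =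
        y - star y - (y * y - star y * star y) + (star y * y - y * star y) := by noncomm_ring
    have h2 : y - star y = y * y - star y * star y := by
      rw [show y - star y = (x' + y ^ 2) - (x' + star y ^ 2) from congrArg₂ _ hy hsy]
      noncomm_ring
    rw [h1, ← h2, hc.eq]
    simp
  have hyy : star y = y := (sub_eq_zero.1 ((hu.mul_left_eq_zero).1 hzero)).symm
  refine ⟨1 - (2 : ℂ) • y, ?_, ?_⟩
  · rw [IsSelfAdjoint, star_sub, star_one, star_smul, hyy]; simp
  · have h4 : x = (4 : ℂ) • (y - y * y) := by
      rw [← sq, sub_eq_of_eq_add hy, hx'def, smul_smul]; norm_num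
    rw [h4]
    simp only [sub_mul, mul_sub, one_mul, mul_one, smul_mul_assoc, mul_smul_comm, smul_smul,
      smul_sub]
    module

end Banach

end BanachStar

namespace BanachStar

open Polynomial Filter Topology

set_option linter.unusedSectionVars false

/-! ### Spectral order in a unital Hermitian Banach algebra. -/

section Hermitian

variable {B : Type*} [NormedRing B] [NormedAlgebra ℂ B] [CompleteSpace B] [Nontrivial B]
  [StarRing B] [StarModule ℂ B]

/-- The real parts of the spectral values of `h` are nonnegative. -/
def SpectrumNonneg (h : B) : Prop :=
  ∀ z ∈ spectrum ℂ h, 0 ≤ z.re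

variable (B) in
/-- The self-adjoint elements of `B` have real spectrum. -/
def HasRealSpectra : Prop :=
  ∀ h : B, IsSelfAdjoint h → ∀ z ∈ spectrum ℂ h, z.im = 0

theorem norm_lt_of_mem_spectrum_mul_comm {a b : B} {c : ℝ} (hc : 0 < c)
    (h : ∀ z ∈ spectrum ℂ (a * b), ‖z‖ < c) : ∀ z ∈ spectrum ℂ (b * a), ‖z‖ < c := by
  intro z hz
  by_cases h0 : z = 0
  · simpa [h0] using hc
  · have : z ∈ spectrum ℂ (b * a) \ {0} := ⟨hz, h0⟩
    rw [spectrum.nonzero_mul_comm] at this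
    exact h z this.1

theorem mem_spectrum_smul {c z : ℂ} {a : B} (hz : z ∈ spectrum ℂ (c • a)) :
    ∃ w ∈ spectrum ℂ a, z = c * w := by
  rw [spectrum.smul_eq_smul _ _ (spectrum.nonempty a)] at hz
  obtain ⟨w, hw, rfl⟩ := hz
  exact ⟨w, hw, rfl⟩

theorem smul_mem_spectrum_smul (c : ℂ) {z : ℂ} {a : B} (hz : z ∈ spectrum ℂ a) :
    c * z ∈ spectrum ℂ (c • a) := by
  rw [spectrum.smul_eq_smul _ _ (spectrum.nonempty a)]
  exact ⟨z, hz, rfl⟩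

theorem algebraMap_sub_mem_spectrum (c : ℂ) {z : ℂ} {a : B} (hz : z ∈ spectrum ℂ a) :
    c - z ∈ spectrum ℂ (algebraMap ℂ B c - a) := by
  rw [← spectrum.singleton_sub_eq]
  exact Set.sub_mem_sub rfl hz

theorem mem_spectrum_algebraMap_sub (c : ℂ) {z : ℂ} {a : B}
    (hz : z ∈ spectrum ℂ (algebraMap ℂ B c - a)) : c - z ∈ spectrum ℂ a := by
  simpa using algebraMap_sub_mem_spectrum c hz

theorem SpectrumNonneg.smul {h : B} (hh : SpectrumNonneg h) {c : ℝ} (hc : 0 ≤ c) :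
    SpectrumNonneg ((c : ℂ) • h) := by
  intro z hz
  obtain ⟨w, hw, rfl⟩ := mem_spectrum_smul hz
  rw [Complex.re_ofReal_mul]
  exact mul_nonneg hc (hh w hw)

theorem _root_.IsSelfAdjoint.ofReal_smul {h : B} (hh : IsSelfAdjoint h) (c : ℝ) :
    IsSelfAdjoint ((c : ℂ) • h) := by
  rw [IsSelfAdjoint, star_smul, hh.star_eq]; simp

theorem _root_.IsSelfAdjoint.mul_self' {h : B} (hh : IsSelfAdjoint h) : IsSelfAdjoint (h * h) := by
  rw [IsSelfAdjoint, star_mul, hh.star_eq]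

theorem isSelfAdjoint_algebraMap_ofReal (c : ℝ) : IsSelfAdjoint (algebraMap ℂ B c) := by
  rw [Algebra.algebraMap_eq_smul_one]
  exact (IsSelfAdjoint.one B).ofReal_smul c

/-! ### The Pták inequality -/

/-- With `s² = 1 - a* a`, the product equals `s² + a* - a = s (1 + k) s`, where `k = s⁻¹ (a* - a)
s⁻¹`. As `i k` is self-adjoint, `-1` is not in the spectrum of `k`. -/
theorem HasRealSpectra.isUnit_mul (hB : HasRealSpectra B) {a : B}
    (ha : ∀ z ∈ spectrum ℂ (star a * a), ‖z‖ < 1) : IsUnit ((1 + star a) * (1 - a)) := by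
  obtain ⟨s, hs, hss⟩ := exists_isSelfAdjoint_sq_eq_one_sub (IsSelfAdjoint.star_mul_self a) ha
  have hu : IsUnit s := by
    have := isUnit_one_sub_of_spectrum_lt ha
    rw [← hss, ← sq] at this
    exact (isUnit_pow_iff two_ne_zero).1 this
  obtain ⟨u, rfl⟩ := hu
  set k : B := ↑u⁻¹ * (star a - a) * ↑u⁻¹ with hk
  have hinv : star (↑u⁻¹ : B) = ↑u⁻¹ := by
    have : star u = u := Units.ext hs
    conv_rhs => rw [← this]
    rw [← star_inv, Units.coe_star]
  have hksa : IsSelfAdjoint (Complex.I • k) := by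
    rw [IsSelfAdjoint, hk, star_smul, star_mul, star_mul, hinv, star_sub, star_star]
    simp only [mul_sub, sub_mul, mul_assoc, smul_sub, Complex.star_def, Complex.conj_I]
    module
  have h1 : IsUnit (1 + k) := by
    by_contra hn
    have hmem : (-1 : ℂ) ∈ spectrum ℂ k := by
      rw [spectrum.mem_iff, map_neg, map_one, ← neg_add', IsUnit.neg_iff]
      exact hn
    simpa using hB _ hksa _ (smul_mem_spectrum_smul Complex.I hmem)
  have heq : (1 + star a) * (1 - a) = u * (1 + k) * u := by
    have : (u : B) * (1 + k) * u = u * u + (star a - a) := by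
      rw [hk]
      simp only [mul_add, add_mul, mul_one, mul_assoc, Units.inv_mul, Units.mul_inv_cancel_left]
    rw [this, hss]
    noncomm_ring
  rw [heq]
  exact (u.isUnit.mul h1).mul u.isUnit

/-- The previous lemma for `a` yields a left inverse of `1 - a`; for `-a*` it yields a right
inverse. -/
theorem HasRealSpectra.isUnit_one_sub (hB : HasRealSpectra B) {a : B}
    (ha : ∀ z ∈ spectrum ℂ (star a * a), ‖z‖ < 1) : IsUnit (1 - a) := by
  have h1 := hB.isUnit_mul ha
  have h2 := hB.isUnit_mul (a := -star a) (by
    simpa using norm_lt_of_mem_spectrum_mul_comm one_pos ha)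
  rw [star_neg, star_star, ← sub_eq_add_neg, sub_neg_eq_add] at h2
  rw [isUnit_iff_exists_and_exists]
  obtain ⟨u, hu⟩ := h1
  obtain ⟨v, hv⟩ := h2
  exact ⟨⟨(1 + star a) * ↑v⁻¹, by rw [← mul_assoc, ← hv, Units.mul_inv]⟩,
    ⟨↑u⁻¹ * (1 + star a), by rw [mul_assoc, ← hu, Units.inv_mul]⟩⟩

theorem HasRealSpectra.norm_lt_one_of_star_mul_self (hB : HasRealSpectra B) {a : B}
    (ha : ∀ z ∈ spectrum ℂ (star a * a), ‖z‖ < 1) : ∀ z ∈ spectrum ℂ a, ‖z‖ < 1 := by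
  intro z hz
  by_contra! hle
  have hz0 : z ≠ 0 := norm_pos_iff.1 (one_pos.trans_le hle)
  have hu := hB.isUnit_one_sub (a := z⁻¹ • a) fun w hw => by
    rw [star_smul, smul_mul_smul_comm] at hw
    obtain ⟨v, hv, rfl⟩ := mem_spectrum_smul hw
    have hzi : ‖z⁻¹‖ ≤ 1 := by rw [norm_inv]; exact inv_le_one_of_one_le₀ hle
    rw [norm_mul, norm_mul, norm_star]
    calc _ ≤ 1 * 1 * ‖v‖ := by gcongr
      _ < 1 := by simpa using ha v hv
  have hmem := smul_mem_spectrum_smul z⁻¹ hz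
  rw [inv_mul_cancel₀ hz0, spectrum.mem_iff, map_one] at hmem
  exact hmem hu

/-! ### Products and sums -/

/-- `(hk)* (hk) = k h² k` has the same nonzero spectrum as `h² k²`, so Pták's inequality applies. -/
theorem HasRealSpectra.norm_lt_one_of_sq_mul_sq (hB : HasRealSpectra B) {h k : B}
    (hh : IsSelfAdjoint h) (hk : IsSelfAdjoint k)
    (hs : ∀ z ∈ spectrum ℂ (h ^ 2 * k ^ 2), ‖z‖ < 1) : ∀ z ∈ spectrum ℂ (h * k), ‖z‖ < 1 := by
  refine hB.norm_lt_one_of_star_mul_self ?_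
  rw [star_mul, hh.star_eq, hk.star_eq, mul_assoc]
  refine norm_lt_of_mem_spectrum_mul_comm one_pos ?_
  rwa [show h * (h * k) * k = h ^ 2 * k ^ 2 by noncomm_ring]

/-- Iterating the squaring step reduces the claim to `h ^ 2 ^ n * k ^ 2 ^ n`. Its norm tends to `0`:
the powers of `h` decay and those of `k` are bounded. -/
theorem HasRealSpectra.norm_lt_one_mul (hB : HasRealSpectra B) {h k : B}
    (hh : IsSelfAdjoint h) (hk : IsSelfAdjoint k) (h1 : ∀ z ∈ spectrum ℂ h, ‖z‖ < 1)
    (k1 : ∀ z ∈ spectrum ℂ k, ‖z‖ < 1) : ∀ z ∈ spectrum ℂ (h * k), ‖z‖ < 1 := by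
  have hiter : ∀ n : ℕ, (∀ z ∈ spectrum ℂ (h ^ 2 ^ n * k ^ 2 ^ n), ‖z‖ < 1) →
      ∀ z ∈ spectrum ℂ (h * k), ‖z‖ < 1 := fun n => by
    induction n with
    | zero => simp
    | succ n ih =>
      intro hs
      refine ih (hB.norm_lt_one_of_sq_mul_sq (hh.pow _) (hk.pow _) ?_)
      rwa [← pow_mul, ← pow_mul, ← pow_succ]
  obtain ⟨ρ, hρ1, hρ0, hρ⟩ := exists_spectrum_lt_lt one_pos h1
  obtain ⟨M, hM0, hM⟩ := exists_norm_pow_le_of_spectrum_lt hρ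
  obtain ⟨N, hN0, hN⟩ := exists_norm_pow_le_of_spectrum_lt k1
  have hlim : Tendsto (fun n : ℕ => M * ρ ^ 2 ^ n * N * ‖(1 : B)‖) atTop
      (𝓝 (M * 0 * N * ‖(1 : B)‖)) :=
    ((((tendsto_pow_atTop_nhds_zero_of_lt_one hρ0 hρ1).comp
      (tendsto_pow_atTop_atTop_of_one_lt one_lt_two)).const_mul M).mul_const N).mul_const _
  obtain ⟨n, hn⟩ := (hlim.eventually_lt_const (u := 1) (by simp)).exists
  refine hiter n fun z hz => (spectrum.norm_le_norm_mul_of_mem hz).trans_lt (lt_of_le_of_lt ?_ hn)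
  gcongr
  refine (norm_mul_le _ _).trans ?_
  gcongr
  · exact hM _
  · simpa using hN (2 ^ n)

/-- The transform `x = 1 - (1 + h)⁻¹`, that is `t ↦ t / (1 + t)`, carries `[0, ∞)` into `[0, 1)`. -/
theorem HasRealSpectra.exists_resolvent (hB : HasRealSpectra B) {h : B} (hh : IsSelfAdjoint h)
    (h0 : SpectrumNonneg h) : ∃ u : Bˣ, ∃ x : B, (u : B) = 1 + h ∧ IsSelfAdjoint x ∧
      u * x = h ∧ x * u = h ∧ ∀ z ∈ spectrum ℂ x, ‖z‖ < 1 := by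
  have hu : IsUnit (1 + h) := by
    by_contra hn
    have hmem : (-1 : ℂ) ∈ spectrum ℂ h := by
      rw [spectrum.mem_iff, map_neg, map_one, ← neg_add', IsUnit.neg_iff]
      exact hn
    have := h0 _ hmem
    norm_num at this
  obtain ⟨u, hu⟩ := hu
  have hinv : star (↑u⁻¹ : B) = ↑u⁻¹ := by
    have : star u = u := Units.ext (by rw [Units.coe_star, hu, star_add, star_one, hh.star_eq])
    conv_rhs => rw [← this]
    rw [← star_inv, Units.coe_star]
  refine ⟨u, 1 - ↑u⁻¹, hu, ?_, ?_, ?_, fun z hz => ?_⟩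
  · rw [IsSelfAdjoint, star_sub, star_one, hinv]
  · rw [mul_sub, mul_one, Units.mul_inv, hu, add_sub_cancel_left]
  · rw [sub_mul, one_mul, Units.inv_mul, hu, add_sub_cancel_left]
  · rw [← map_one (algebraMap ℂ B)] at hz
    have h1 := mem_spectrum_algebraMap_sub _ hz
    rw [← spectrum.map_inv, Set.mem_inv, hu, ← map_one (algebraMap ℂ B)] at h1
    have h2 : (1 - z)⁻¹ - 1 ∈ spectrum ℂ h := by
      rw [← spectrum.singleton_add_eq] at h1
      obtain ⟨_, rfl, w, hw, he⟩ := h1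
      simp only at he
      rwa [← he, add_sub_cancel_left]
    set t := (1 - z)⁻¹ - 1 with ht
    have ht0 := h0 t h2
    have htr : t = (t.re : ℂ) := Complex.ext rfl (by simpa using hB h hh t h2)
    have hne : (1 + t.re : ℂ) ≠ 0 := by
      exact_mod_cast (by positivity : (0 : ℝ) < 1 + t.re).ne'
    have hz' : z = ((1 - (1 + t.re)⁻¹ : ℝ) : ℂ) := by
      push_cast
      rw [← htr, ht, add_sub_cancel, inv_inv, sub_sub_cancel]
    rw [hz', Complex.norm_real, Real.norm_eq_abs, abs_lt]
    have h3 : 0 < (1 + t.re)⁻¹ := by positivity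
    have h4 : (1 + t.re)⁻¹ ≤ 1 := inv_le_one_of_one_le₀ (by linarith)
    constructor <;> linarith

/-- With `u = 1 + h = u x + 1` and `v = 1 + k = y v + 1`, one has `1 + h + k = u v - h k = u (1 - x
y) v`. -/
theorem HasRealSpectra.isUnit_one_add_add (hB : HasRealSpectra B) {h k : B}
    (hh : IsSelfAdjoint h) (hk : IsSelfAdjoint k) (h0 : SpectrumNonneg h)
    (k0 : SpectrumNonneg k) : IsUnit (1 + h + k) := by
  obtain ⟨u, x, hu, hx, hux, -, hx1⟩ := hB.exists_resolvent hh h0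
  obtain ⟨v, y, hv, hy, -, hyv, hy1⟩ := hB.exists_resolvent hk k0
  have h1 : IsUnit (1 - x * y) :=
    isUnit_one_sub_of_spectrum_lt (hB.norm_lt_one_mul hx hy hx1 hy1)
  have heq : 1 + h + k = u * (1 - x * y) * v := by
    rw [mul_sub, sub_mul, mul_one, ← mul_assoc, hux, mul_assoc, hyv, hu, hv]
    noncomm_ring
  rw [heq]
  exact (u.isUnit.mul h1).mul v.isUnit

theorem HasRealSpectra.add_nonneg (hB : HasRealSpectra B) {h k : B}
    (hh : IsSelfAdjoint h) (hk : IsSelfAdjoint k) (h0 : SpectrumNonneg h)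
    (k0 : SpectrumNonneg k) : SpectrumNonneg (h + k) := by
  intro z hz
  by_contra! hlt
  set c : ℝ := -z.re with hc
  have hc0 : 0 < c := neg_pos.2 hlt
  have hzc : z = -(c : ℂ) := Complex.ext (by simp [hc]) (by simpa using hB _ (hh.add hk) z hz)
  have hi : 0 ≤ c⁻¹ := by positivity
  -- Dividing by `c` moves the supposed spectral value `-c` to `-1`.
  have hu := hB.isUnit_one_add_add (hh.ofReal_smul c⁻¹) (hk.ofReal_smul c⁻¹) (h0.smul hi)
    (k0.smul hi)
  have hmem := smul_mem_spectrum_smul ((c⁻¹ : ℝ) : ℂ) hz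
  have hcc : (c : ℂ) ≠ 0 := by exact_mod_cast hc0.ne'
  rw [hzc, Complex.ofReal_inv, mul_neg, inv_mul_cancel₀ hcc, spectrum.mem_iff, map_neg, map_one,
    ← neg_add', IsUnit.neg_iff, smul_add, ← add_assoc] at hmem
  rw [Complex.ofReal_inv] at hu
  exact hmem hu

theorem HasRealSpectra.mul_self_nonneg (hB : HasRealSpectra B) {h : B} (hh : IsSelfAdjoint h) :
    SpectrumNonneg (h * h) := by
  intro z hz
  rw [← sq, spectrum.map_pow] at hz
  obtain ⟨w, hw, rfl⟩ := hz
  have := hB h hh w hw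
  simp [sq, this, _root_.mul_self_nonneg]

/-! ### The Shirali-Ford theorem -/

/-- With `p = b + b*` and `q = i (b - b*)`, one has `p² + q² = 2 (b b* + b* b)`. Hence `2 (1 + b* b)
= 2 (1 - b b*) + p² + q²` is a sum of elements with nonnegative spectrum. -/
theorem HasRealSpectra.neg_one_le_of_le_one (hB : HasRealSpectra B) {b : B}
    (hb : ∀ z ∈ spectrum ℂ (star b * b), z.re ≤ 1) :
    ∀ z ∈ spectrum ℂ (star b * b), -1 ≤ z.re := by
  have h1 : SpectrumNonneg ((2 : ℝ) • (1 - b * star b)) := by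
    refine SpectrumNonneg.smul (fun z hz => ?_) zero_le_two
    rw [← map_one (algebraMap ℂ B)] at hz
    have h2 := mem_spectrum_algebraMap_sub _ hz
    by_cases h0 : 1 - z = 0
    · rw [← sub_eq_zero.1 h0]; simp
    · have h3 : 1 - z ∈ spectrum ℂ (b * star b) \ {0} := ⟨h2, h0⟩
      rw [spectrum.nonzero_mul_comm] at h3
      have := hb _ h3.1
      simp at this
      exact this
  have hp : IsSelfAdjoint (b + star b) := IsSelfAdjoint.add_star_self b
  have hq : IsSelfAdjoint (Complex.I • (b - star b)) := by
    rw [IsSelfAdjoint, star_smul, star_sub, star_star]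
    simp only [smul_sub, Complex.star_def, Complex.conj_I]
    module
  have hpq := hB.add_nonneg hp.mul_self' hq.mul_self' (hB.mul_self_nonneg hp)
    (hB.mul_self_nonneg hq)
  have hsum := hB.add_nonneg (((IsSelfAdjoint.one B).sub
    (IsSelfAdjoint.mul_star_self b)).ofReal_smul 2) (hp.mul_self'.add hq.mul_self') h1 hpq
  intro z hz
  have heq : ((2 : ℝ) : ℂ) • (1 - b * star b) + ((b + star b) * (b + star b) +
      Complex.I • (b - star b) * Complex.I • (b - star b)) =
      algebraMap ℂ B 2 - (-2 : ℂ) • (star b * b) := by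
    rw [smul_mul_smul_comm, Complex.I_mul_I, Algebra.algebraMap_eq_smul_one]
    simp only [mul_add, add_mul, mul_sub, sub_mul]
    push_cast
    module
  rw [heq] at hsum
  have := hsum _ (algebraMap_sub_mem_spectrum 2 (smul_mem_spectrum_smul (-2) hz))
  simp at this
  linarith

/-- Put `x = a* a` and `b = a (1 - x)^n`, so that `b* b = x (1 - x)^(2n)`. On `[-1, 1]` this
function is at most `1`, so the previous lemma bounds it below by `-1` on the spectrum. At a
negative spectral value it would tend to `-∞`. -/
theorem HasRealSpectra.star_mul_self_nonneg_of_norm_le (hB : HasRealSpectra B) {a : B}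
    (ha : ∀ z ∈ spectrum ℂ (star a * a), ‖z‖ ≤ 1) : SpectrumNonneg (star a * a) := by
  intro z hz
  by_contra! hlt
  have hreal := hB _ (IsSelfAdjoint.star_mul_self a)
  have hbound : ∀ n : ℕ, -1 ≤ z.re * (1 - z.re) ^ (2 * n) := fun n => by
    have heq : star (a * (1 - star a * a) ^ n) * (a * (1 - star a * a) ^ n) =
        aeval (star a * a) ((X : ℂ[X]) * (1 - X) ^ (2 * n)) := by
      have hc : Commute (star a * a) ((1 - star a * a) ^ n) :=
        ((Commute.one_right _).sub_right (Commute.refl _)).pow_right n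
      simp only [map_mul, map_pow, map_sub, map_one, aeval_X, star_mul, star_pow, star_sub,
        star_one, star_star]
      calc _ = (1 - star a * a) ^ n * (star a * a) * (1 - star a * a) ^ n := by
            simp only [mul_assoc]
        _ = _ := by rw [← hc.eq, mul_assoc, ← pow_add, two_mul]
    have hev : ∀ w ∈ spectrum ℂ (star a * a),
        (eval w ((X : ℂ[X]) * (1 - X) ^ (2 * n))).re = w.re * (1 - w.re) ^ (2 * n) :=
      fun w hw => by
        have hw' : w = (w.re : ℂ) := Complex.ext rfl (by simpa using hreal w hw)
        conv_lhs => rw [hw']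
        simp only [eval_mul, eval_X, eval_pow, eval_sub, eval_one]
        norm_cast
    have := hB.neg_one_le_of_le_one (b := a * (1 - star a * a) ^ n) (by
      rw [heq, spectrum.map_polynomial_aeval]
      rintro _ ⟨w, hw, rfl⟩
      simp only [hev w hw]
      have h1 : |w.re| ≤ 1 := (Complex.abs_re_le_norm w).trans (ha w hw)
      rw [abs_le] at h1
      rcases le_total w.re 0 with hneg | hpos
      · refine le_trans (mul_nonpos_of_nonpos_of_nonneg hneg ?_) zero_le_one
        exact pow_nonneg (by linarith) _
      · exact mul_le_one₀ h1.2 (pow_nonneg (by linarith) _)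
          (pow_le_one₀ (by linarith) (by linarith)))
    rw [heq, spectrum.map_polynomial_aeval] at this
    have := this _ ⟨z, hz, rfl⟩
    rwa [hev z hz] at this
  have hlim : Tendsto (fun n : ℕ => (1 - z.re) ^ (2 * n)) atTop atTop := by
    simp only [pow_mul]
    exact tendsto_pow_atTop_atTop_of_one_lt (by nlinarith)
  obtain ⟨n, hn⟩ := (hlim.eventually_gt_atTop ((-z.re)⁻¹)).exists
  have h1 := mul_lt_mul_of_pos_left hn (neg_pos.2 hlt)
  rw [mul_inv_cancel₀ (neg_pos.2 hlt).ne'] at h1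
  linarith [hbound n]

theorem HasRealSpectra.star_mul_self_nonneg (hB : HasRealSpectra B) (a : B) :
    SpectrumNonneg (star a * a) := by
  set R : ℝ := ‖star a * a‖ * ‖(1 : B)‖ + 1 with hR
  have hR0 : 0 < R := by positivity
  set c : ℝ := Real.sqrt R⁻¹ with hc
  have hcc : (c : ℂ) * c = ((R⁻¹ : ℝ) : ℂ) := by
    rw [← Complex.ofReal_mul, Real.mul_self_sqrt (by positivity)]
  have hsm : star ((c : ℂ) • a) * ((c : ℂ) • a) = ((R⁻¹ : ℝ) : ℂ) • (star a * a) := by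
    rw [star_smul, smul_mul_smul_comm, ← hcc]; simp
  have h1 := hB.star_mul_self_nonneg_of_norm_le (a := (c : ℂ) • a) (by
    rw [hsm]
    intro z hz
    obtain ⟨w, hw, rfl⟩ := mem_spectrum_smul hz
    have := spectrum.norm_le_norm_mul_of_mem hw
    rw [norm_mul, Complex.norm_real, Real.norm_of_nonneg (by positivity),
      inv_mul_le_iff₀ hR0]
    linarith)
  rw [hsm] at h1
  have h2 := h1.smul hR0.le
  rwa [smul_smul, ← Complex.ofReal_mul, mul_inv_cancel₀ hR0.ne', Complex.ofReal_one,
    one_smul] at h2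

end Hermitian

end BanachStar

namespace BanachStar

open Polynomial Filter Topology
open scoped ComplexOrder ComplexStarModule Pointwise

set_option linter.unusedSectionVars false

/-! ### Positive functionals from the Hahn-Banach theorem. -/

section Hermitian

variable {B : Type*} [NormedRing B] [NormedAlgebra ℂ B] [CompleteSpace B] [Nontrivial B]
  [StarRing B] [StarModule ℂ B]

/-- The supremum of the real parts of the spectral values. -/
noncomputable def specSup (h : B) : ℝ :=
  sSup (Complex.re '' spectrum ℂ h)

theorem bddAbove_re_spectrum (h : B) : BddAbove (Complex.re '' spectrum ℂ h) :=
  ((spectrum.isCompact h).image Complex.continuous_re).bddAbove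

theorem le_specSup {h : B} {z : ℂ} (hz : z ∈ spectrum ℂ h) : z.re ≤ specSup h :=
  le_csSup (bddAbove_re_spectrum h) ⟨z, hz, rfl⟩

theorem specSup_le {h : B} {c : ℝ} (hc : ∀ z ∈ spectrum ℂ h, z.re ≤ c) : specSup h ≤ c :=
  csSup_le ((spectrum.nonempty h).image _) (by rintro _ ⟨z, hz, rfl⟩; exact hc z hz)

theorem spectrumNonneg_specSup_sub (h : B) : SpectrumNonneg (algebraMap ℂ B (specSup h) - h) := by
  intro z hz
  have := le_specSup (mem_spectrum_algebraMap_sub _ hz)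
  simp at this
  exact this

theorem specSup_smul {c : ℝ} (hc : 0 ≤ c) (h : B) : specSup ((c : ℂ) • h) = c * specSup h := by
  have : Complex.re '' spectrum ℂ ((c : ℂ) • h) = c • (Complex.re '' spectrum ℂ h) := by
    rw [spectrum.smul_eq_smul _ _ (spectrum.nonempty h)]
    ext x
    simp [Set.mem_smul_set]
  rw [specSup, this, Real.sSup_smul_of_nonneg hc, smul_eq_mul, specSup]

/-- Add the elements `specSup h - h` and `specSup k - k`, both with nonnegative spectrum. This is
the subadditivity needed for Hahn-Banach. -/
theorem HasRealSpectra.specSup_add_le (hB : HasRealSpectra B) {h k : B} (hh : IsSelfAdjoint h)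
    (hk : IsSelfAdjoint k) : specSup (h + k) ≤ specSup h + specSup k := by
  refine specSup_le fun z hz => ?_
  have h1 := hB.add_nonneg ((isSelfAdjoint_algebraMap_ofReal (specSup h)).sub hh)
    ((isSelfAdjoint_algebraMap_ofReal (specSup k)).sub hk)
    (spectrumNonneg_specSup_sub h) (spectrumNonneg_specSup_sub k)
  rw [sub_add_sub_comm, ← map_add] at h1
  have := h1 _ (algebraMap_sub_mem_spectrum _ hz)
  simp at this
  exact this

/-- For each self-adjoint `x ≠ 0` there is a real functional on the self-adjoint part which is
dominated by the spectral supremum and attains it at `x`. -/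
theorem HasRealSpectra.exists_real_functional (hB : HasRealSpectra B) (x : selfAdjoint B)
    (hx : x ≠ 0) : ∃ f : selfAdjoint B →ₗ[ℝ] ℝ, f x = specSup (x : B) ∧
      ∀ h : selfAdjoint B, f h ≤ specSup (h : B) := by
  have hcoe : ∀ (c : ℝ) (h : selfAdjoint B), ((c • h : selfAdjoint B) : B) = (c : ℂ) • (h : B) :=
    fun c h => by simp
  obtain ⟨g, hg, hle⟩ := exists_extension_of_le_sublinear
    (LinearPMap.mkSpanSingleton (K := ℝ) x (specSup (x : B)) hx)
    (fun h : selfAdjoint B => specSup (h : B))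
    (fun c hc h => by simp only [hcoe]; exact specSup_smul hc.le _)
    (fun h k => hB.specSup_add_le h.2 k.2) (by
      rintro ⟨y, hy⟩
      obtain ⟨c, rfl⟩ := Submodule.mem_span_singleton.1 hy
      rw [LinearPMap.mkSpanSingleton'_apply]
      simp only [hcoe, smul_eq_mul, RingHom.id_apply]
      rcases le_total 0 c with hc | hc
      · rw [specSup_smul hc]
      -- For negative `c`, domination follows from `0 = specSup (c x + (-c) x) ≤ specSup (c x) - c
      -- specSup x`.
      · have h1 := hB.specSup_add_le (x.2.ofReal_smul c) (x.2.ofReal_smul (-c))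
        rw [specSup_smul (neg_nonneg.2 hc), ← add_smul] at h1
        have h0 : specSup (0 : B) = 0 := by simp [specSup]
        rw [← Complex.ofReal_add, add_neg_cancel, Complex.ofReal_zero, zero_smul, h0] at h1
        linarith)
  refine ⟨g, ?_, hle⟩
  have := hg ⟨x, Submodule.mem_span_singleton_self x⟩
  exact this.trans (LinearPMap.mkSpanSingleton'_apply_self _ _ _ _)

/-- A Hermitian algebra has, for each `a` with `a* a ≠ 0`, a positive unital functional which is
bounded by the spectral radius on the self-adjoint part and attains it at `a* a`. -/
theorem HasRealSpectra.exists_positiveFunctional (hB : HasRealSpectra B) (a : B)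
    (ha : star a * a ≠ 0) : ∃ φ : B →ₗ[ℂ] ℂ, IsPositiveFunctional φ ∧ φ 1 = 1 ∧
      (∀ (h : B) (R : ℝ), IsSelfAdjoint h → (∀ z ∈ spectrum ℂ h, ‖z‖ ≤ R) → ‖φ h‖ ≤ R) ∧
      ∀ z ∈ spectrum ℂ (star a * a), ‖z‖ ≤ (φ (star a * a)).re := by
  obtain ⟨f, hfx, hf⟩ := hB.exists_real_functional
    ⟨star a * a, IsSelfAdjoint.star_mul_self a⟩ fun h => ha (congrArg Subtype.val h)
  set φ : Module.Dual ℂ B := Module.Dual.extendRCLike (𝕜 := ℂ) (f ∘ₗ (realPart : B →ₗ[ℝ] _)) with hφ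
  have hφsa : ∀ h : selfAdjoint B, φ (h : B) = (f h : ℂ) := fun h => by
    rw [hφ, Module.Dual.extendRCLike_apply]
    simp [realPart_I_smul]
  have hφsa' : ∀ (h : B) (hh : IsSelfAdjoint h), φ h = (f ⟨h, hh⟩ : ℂ) := fun h hh => hφsa ⟨h, hh⟩
  -- Domination at `-h` is a lower bound at `h`; with Shirali-Ford it gives positivity.
  have hneg : ∀ (h : B) (hh : IsSelfAdjoint h), -specSup (-h) ≤ f ⟨h, hh⟩ := fun h hh => by
    have h1 := hf (-⟨h, hh⟩)
    rw [map_neg] at h1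
    have h2 : ((-⟨h, hh⟩ : selfAdjoint B) : B) = -h := rfl
    rw [h2] at h1
    linarith
  refine ⟨φ, fun b => ?_, ?_, fun h R hh hR => ?_, fun z hz => ?_⟩
  · have hb := IsSelfAdjoint.star_mul_self b
    rw [hφsa' _ hb]
    refine Complex.zero_le_real.2 (le_trans (neg_nonneg.2 (specSup_le fun z hz => ?_)) (hneg _ hb))
    rw [← spectrum.neg_eq, Set.mem_neg] at hz
    simpa using hB.star_mul_self_nonneg b _ hz
  · rw [hφsa' 1 (IsSelfAdjoint.one B)]
    have h1 : specSup (1 : B) = 1 := by simp [specSup]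
    have h2 : specSup (-1 : B) = -1 := by
      rw [specSup, ← spectrum.neg_eq]; simp
    have h3 := hf ⟨1, IsSelfAdjoint.one B⟩
    have h4 := hneg 1 (IsSelfAdjoint.one B)
    simp only [h1, h2] at h3 h4
    exact_mod_cast le_antisymm h3 (by linarith)
  · rw [hφsa' h hh, Complex.norm_real, Real.norm_eq_abs, abs_le]
    constructor
    · refine le_trans (neg_le_neg (specSup_le fun z hz => ?_)) (hneg h hh)
      rw [← spectrum.neg_eq, Set.mem_neg] at hz
      exact (Complex.re_le_norm z).trans (by simpa using hR _ hz)
    · exact (hf ⟨h, hh⟩).trans (specSup_le fun z hz => (Complex.re_le_norm z).trans (hR z hz))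
  · have hsa := IsSelfAdjoint.star_mul_self a
    rw [hφsa' _ hsa, hfx, Complex.ofReal_re]
    have h1 : z = (z.re : ℂ) := Complex.ext rfl (by simpa using hB _ hsa z hz)
    rw [h1, Complex.norm_real, Real.norm_of_nonneg (hB.star_mul_self_nonneg a z hz)]
    exact le_specSup hz

end Hermitian

end BanachStar

namespace BanachStar

open Filter Topology
open scoped ComplexOrder InnerProductSpace

set_option linter.unusedSectionVars false

/-! ### GNS spaces, vector states and the universal representation. -/

section Representations

variable {A : Type*} [NonUnitalNormedRing A] [NormedSpace ℂ A] [IsScalarTower ℂ A A]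
  [SMulCommClass ℂ A A] [StarRing A] [StarModule ℂ A]

/-- The infimum defining the variation is attained, by letting admissible bounds tend to `1`. -/
theorem IsState.norm_sq_le {ψ : A →ₗ[ℂ] ℂ} (h : IsState ψ) (a : A) :
    ‖ψ a‖ ^ 2 ≤ (ψ (star a * a)).re := by
  refine le_of_forall_pos_le_add fun ε hε => ?_
  have hP := h.positive.re_nonneg a
  set P := (ψ (star a * a)).re with hPdef
  have hlt : sInf (variationBounds ψ) < 1 + ε / (P + 1) := by
    rw [h.variation_eq_one]
    linarith [div_pos hε (by linarith : 0 < P + 1)]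
  obtain ⟨v, hv, hvlt⟩ := exists_lt_of_csInf_lt h.finiteVariation hlt
  calc _ ≤ v * P := hv.2 a
    _ ≤ (1 + ε / (P + 1)) * P := by gcongr
    _ = P + ε * (P / (P + 1)) := by ring
    _ ≤ P + ε * 1 := by
      gcongr
      exact (div_le_one (by linarith)).2 (by linarith)
    _ = _ := by rw [mul_one]

theorem isLeast_variationBounds_of_sInf_eq_one {ψ : A →ₗ[ℂ] ℂ}
    (h1 : (1 : ℝ) ∈ variationBounds ψ) (h : ∀ v ∈ variationBounds ψ, 1 ≤ v) :
    sInf (variationBounds ψ) = 1 :=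
  IsLeast.csInf_eq ⟨h1, h⟩

theorem norm_gns_of (ψ : State A) (a : A) :
    ‖(PreGNS.of ψ a : GNS ψ)‖ ^ 2 = (ψ.1 (star a * a)).re := by
  rw [UniformSpace.Completion.norm_coe, PreGNS.norm_sq, LinearEquiv.symm_apply_apply]

theorem inner_gns_of (ψ : State A) (a b : A) :
    ⟪(PreGNS.of ψ a : GNS ψ), (PreGNS.of ψ b : GNS ψ)⟫_ℂ = ψ.1 (star a * b) := by
  rw [UniformSpace.Completion.inner_coe, PreGNS.inner_def]
  simp only [LinearEquiv.symm_apply_apply]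

theorem gns_dense {ψ : State A} {p : GNS ψ → Prop} (hp : IsClosed {x | p x})
    (h : ∀ a : A, p (PreGNS.of ψ a : GNS ψ)) (x : GNS ψ) : p x := by
  induction x using UniformSpace.Completion.induction_on with
  | hp => exact hp
  | ih x => exact h ((PreGNS.of ψ).symm x)

theorem gnsOp_star_inner_right (ψ : State A) (a : A) (x y : GNS ψ) :
    ⟪x, gnsOp ψ (star a) y⟫_ℂ = ⟪gnsOp ψ a x, y⟫_ℂ := by
  have := gnsOp_star_inner ψ (star a) x y
  rwa [star_star, eq_comm] at this

/-- The cyclic vector of the GNS representation of a state. -/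
theorem exists_cyclic_vector (ψ : State A) :
    ∃ c : GNS ψ, ‖c‖ ≤ 1 ∧ ∀ a : A, gnsOp ψ a c = (PreGNS.of ψ a : GNS ψ) := by
  -- Without a unit in `A`, the cyclic vector is the Riesz vector of `ψ`, which finite variation
  -- makes bounded on `H_ψ`.
  have hb : ∀ x : PreGNS ψ, ‖(ψ.1 ∘ₗ (PreGNS.of ψ).symm.toLinearMap) x‖ ≤ 1 * ‖x‖ := fun x => by
    rw [one_mul, ← sq_le_sq₀ (norm_nonneg _) (norm_nonneg _), PreGNS.norm_sq]
    exact ψ.2.norm_sq_le _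
  set f : PreGNS ψ →L[ℂ] ℂ := LinearMap.mkContinuous _ 1 hb with hf
  have hfn : ‖f‖ ≤ 1 := LinearMap.mkContinuous_norm_le _ zero_le_one _
  set g : StrongDual ℂ (GNS ψ) := f.extend (UniformSpace.Completion.toComplL : PreGNS ψ →L[ℂ] GNS ψ) with hg
  have hge : ∀ a : A, g (PreGNS.of ψ a : GNS ψ) = ψ.1 a := fun a =>
    ContinuousLinearMap.extend_eq f (UniformSpace.Completion.denseRange_coe)
      (UniformSpace.Completion.isUniformInducing_coe _) _
  have hgn : ∀ x, ‖g x‖ ≤ 1 * ‖x‖ := gns_dense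
    (isClosed_le (by fun_prop) (by fun_prop)) fun a => by
      rw [hge, UniformSpace.Completion.norm_coe]
      exact hb (PreGNS.of ψ a)
  refine ⟨(InnerProductSpace.toDual ℂ (GNS ψ)).symm g, ?_, fun a => ?_⟩
  · rw [LinearIsometryEquiv.norm_map]
    exact ContinuousLinearMap.opNorm_le_bound _ zero_le_one hgn
  · refine ext_inner_right ℂ fun x => ?_
    refine gns_dense (p := fun x => ⟪gnsOp ψ a ((InnerProductSpace.toDual ℂ (GNS ψ)).symm g), x⟫_ℂ
      = ⟪(PreGNS.of ψ a : GNS ψ), x⟫_ℂ) (isClosed_eq (by fun_prop) (by fun_prop)) (fun b => ?_) x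
    rw [← gnsOp_star_inner_right, InnerProductSpace.toDual_symm_apply, gnsOp_of, hge, inner_gns_of]

theorem gns_eq_zero_of_gnsOp_eq_zero (ψ : State A) {x : GNS ψ} (h : ∀ a : A, gnsOp ψ a x = 0) :
    x = 0 := by
  obtain ⟨c, -, hc⟩ := exists_cyclic_vector ψ
  refine ext_inner_right ℂ fun y => ?_
  refine gns_dense (p := fun y => ⟪x, y⟫_ℂ = ⟪(0 : GNS ψ), y⟫_ℂ)
    (isClosed_eq (by fun_prop) (by fun_prop)) (fun a => ?_) y
  rw [← hc, ← gnsOp_star_inner ψ a x c, h, inner_zero_left, inner_zero_left]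

/-- The linear map `a ↦ π_ψ(a) x`. -/
noncomputable def gnsOrbitMap (ψ : State A) (x : GNS ψ) : A →ₗ[ℂ] GNS ψ where
  toFun a := gnsOp ψ a x
  map_add' a b := by rw [gnsOp_add]; rfl
  map_smul' c a := by rw [gnsOp_smul]; rfl

/-- Each vector of a GNS space lies in the closed cyclic subspace which it generates. -/
theorem mem_closure_range_gnsOp (ψ : State A) (x : GNS ψ) :
    x ∈ (LinearMap.range (gnsOrbitMap ψ x)).topologicalClosure := by
  set K := LinearMap.range (gnsOrbitMap ψ x) with hK
  have hmem : ∀ a, gnsOp ψ a x ∈ K := fun a => ⟨a, rfl⟩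
  rw [← Submodule.orthogonal_orthogonal_eq_closure]
  obtain ⟨u, hu, w, hw, hxw⟩ := Kᗮ.exists_add_mem_mem_orthogonal x
  -- `‖π(d) u‖² = ⟨π(d* d) u, x - w⟩`. Moving `d* d` across kills the `x` term; invariance of `Kᗮ`
  -- kills the `w` term. Nondegeneracy then gives `u = 0`.
  have hu0 : u = 0 := gns_eq_zero_of_gnsOp_eq_zero ψ fun d => by
    have hinv : gnsOp ψ (star d * d) u ∈ Kᗮ := by
      rintro _ ⟨a, rfl⟩
      have h1 : ⟪gnsOp ψ a x, gnsOp ψ (star d * d) u⟫_ℂ = ⟪gnsOp ψ (star d * d * a) x, u⟫_ℂ := by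
        conv_lhs => rw [show star d * d = star (star d * d) by rw [star_mul, star_star]]
        rw [gnsOp_star_inner_right, gnsOp_mul ψ (star d * d) a]
        rfl
      exact h1.trans (hu _ (hmem _))
    rw [← inner_self_eq_zero (𝕜 := ℂ), ← gnsOp_star_inner]
    have h2 : gnsOp ψ (star d) (gnsOp ψ d u) = gnsOp ψ (star d * d) u := by
      rw [gnsOp_mul]; rfl
    rw [h2]
    have h3 : ⟪gnsOp ψ (star d * d) u, x⟫_ℂ = 0 := by
      have h4 := gnsOp_star_inner ψ (star d * d) u x
      rw [star_mul, star_star] at h4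
      rw [h4]
      exact Submodule.inner_left_of_mem_orthogonal (hmem _) hu
    have h5 : ⟪gnsOp ψ (star d * d) u, w⟫_ℂ = 0 := hw _ hinv
    have h6 : u = x - w := by rw [hxw]; abel
    conv_lhs => rw [show ⟪gnsOp ψ (star d * d) u, u⟫_ℂ = ⟪gnsOp ψ (star d * d) u, x - w⟫_ℂ by
      congr 1]
    rw [inner_sub_right, h3, h5, sub_zero]
  rw [hxw, hu0, zero_add]
  exact hw

/-- The functional `a ↦ ψ(b* a b)`. -/
noncomputable def conjFunctional (ψ : A →ₗ[ℂ] ℂ) (b : A) : A →ₗ[ℂ] ℂ :=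
  ψ ∘ₗ LinearMap.mulLeft ℂ (star b) ∘ₗ LinearMap.mulRight ℂ b

theorem conjFunctional_apply (ψ : A →ₗ[ℂ] ℂ) (b a : A) :
    conjFunctional ψ b a = ψ (star b * (a * b)) := rfl

theorem conjFunctional_eq_inner (ψ : State A) (b a : A) : conjFunctional ψ.1 b a =
    ⟪(PreGNS.of ψ b : GNS ψ), gnsOp ψ a (PreGNS.of ψ b : GNS ψ)⟫_ℂ := by
  rw [gnsOp_of, inner_gns_of, conjFunctional_apply]

theorem re_conjFunctional_star_mul_self (ψ : State A) (b a : A) :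
    (conjFunctional ψ.1 b (star a * a)).re = ‖gnsOp ψ a (PreGNS.of ψ b : GNS ψ)‖ ^ 2 := by
  rw [gnsOp_of, norm_gns_of, conjFunctional_apply, star_mul]
  simp only [mul_assoc]

/-- This is the vector state of the unit vector `x` given by `b`. A variation bound `v` says `|⟨x,
y⟩|² ≤ v ‖y‖²` for `y` in `π(A) x`, hence on its closure. That closure contains `x`, so `1 ≤ v`. -/
theorem isState_conjFunctional (ψ : State A) {b : A} (hb : ‖(PreGNS.of ψ b : GNS ψ)‖ = 1) :
    IsState (conjFunctional ψ.1 b) := by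
  set x : GNS ψ := (PreGNS.of ψ b : GNS ψ) with hx
  have h1 : (1 : ℝ) ∈ variationBounds (conjFunctional ψ.1 b) := by
    refine ⟨zero_le_one, fun a => ?_⟩
    rw [re_conjFunctional_star_mul_self, conjFunctional_eq_inner, one_mul]
    have := norm_inner_le_norm (𝕜 := ℂ) x (gnsOp ψ a x)
    rw [hb, one_mul] at this
    gcongr
  refine ⟨fun a => ?_, fun d => ?_, ⟨1, h1⟩, isLeast_variationBounds_of_sInf_eq_one h1 fun v hv => ?_⟩
  · have := ψ.2.positive (a * b)
    rwa [conjFunctional_apply, show star b * (star a * a * b) = star (a * b) * (a * b) by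
      simp only [star_mul, mul_assoc]]
  · refine (ψ.2.weaklyContinuous (d * b)).congr fun a _ => ?_
    simp only [conjFunctional_apply, star_mul, mul_assoc]
  · have hle : ∀ y ∈ (LinearMap.range (gnsOrbitMap ψ x)).topologicalClosure, 
        ‖⟪x, y⟫_ℂ‖ ^ 2 ≤ v * ‖y‖ ^ 2 := by
      intro y hy
      refine closure_minimal (t := {y : GNS ψ | ‖⟪x, y⟫_ℂ‖ ^ 2 ≤ v * ‖y‖ ^ 2}) ?_
        (isClosed_le (by fun_prop) (by fun_prop)) hy
      rintro _ ⟨a, rfl⟩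
      have := hv.2 a
      rwa [re_conjFunctional_star_mul_self, conjFunctional_eq_inner] at this
    have := hle x (mem_closure_range_gnsOp ψ x)
    rw [inner_self_eq_norm_sq_to_K, hb] at this
    simpa using this

/-! ### The Gelfand-Naimark seminorm is the norm of the universal representation -/

theorem norm_gnsOp_le (ψ : State A) (a : A) : ‖gnsOp ψ a‖ ≤ Real.sqrt (‖star a * a‖ + 1) :=
  ContinuousLinearMap.opNorm_le_bound _ (Real.sqrt_nonneg _) (gnsOp_norm_le ψ a)

theorem sqrt_state_le_norm_gnsOp (ψ : State A) (a : A) :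
    Real.sqrt (ψ.1 (star a * a)).re ≤ ‖gnsOp ψ a‖ := by
  obtain ⟨c, hc1, hc⟩ := exists_cyclic_vector ψ
  rw [← norm_gns_of, Real.sqrt_sq (norm_nonneg _), ← hc]
  exact ((gnsOp ψ a).le_opNorm c).trans (mul_le_of_le_one_right (norm_nonneg _) hc1)

theorem bddAbove_sqrt_state (a : A) :
    BddAbove (Set.range fun ψ : State A => Real.sqrt (ψ.1 (star a * a)).re) := by
  refine ⟨Real.sqrt (‖star a * a‖ + 1), ?_⟩
  rintro _ ⟨ψ, rfl⟩
  exact (sqrt_state_le_norm_gnsOp ψ a).trans (norm_gnsOp_le ψ a)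

theorem gnSeminorm_nonneg (a : A) : 0 ≤ gnSeminorm a :=
  Real.iSup_nonneg fun _ => Real.sqrt_nonneg _

/-- By density `x` may be taken from `A`; if nonzero, it is normalized and its vector state is
compared with the supremum. -/
theorem norm_gnsOp_apply_le (ψ : State A) (a : A) (x : GNS ψ) :
    ‖gnsOp ψ a x‖ ≤ gnSeminorm a * ‖x‖ := by
  refine gns_dense (p := fun x => ‖gnsOp ψ a x‖ ≤ gnSeminorm a * ‖x‖)
    (isClosed_le (by fun_prop) (by fun_prop)) (fun b => ?_) x
  set t := ‖(PreGNS.of ψ b : GNS ψ)‖ with ht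
  by_cases h0 : t = 0
  · rw [norm_eq_zero.1 (ht.symm.trans h0), map_zero, norm_zero, h0, mul_zero]
  · have htc : (t : ℂ) ≠ 0 := by exact_mod_cast h0
    have hsm : (PreGNS.of ψ (((t⁻¹ : ℝ) : ℂ) • b) : GNS ψ) =
        ((t⁻¹ : ℝ) : ℂ) • (PreGNS.of ψ b : GNS ψ) := by
      rw [map_smul, UniformSpace.Completion.coe_smul]
    have hti : 0 ≤ t⁻¹ := inv_nonneg.2 (norm_nonneg _)
    have h1 : ‖(PreGNS.of ψ (((t⁻¹ : ℝ) : ℂ) • b) : GNS ψ)‖ = 1 := by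
      rw [hsm, norm_smul, Complex.norm_real, Real.norm_of_nonneg hti, ← ht, inv_mul_cancel₀ h0]
    have h2 := le_ciSup (bddAbove_sqrt_state a) ⟨_, isState_conjFunctional ψ h1⟩
    simp only [re_conjFunctional_star_mul_self, Real.sqrt_sq (norm_nonneg _)] at h2
    rw [hsm, map_smul, norm_smul, Complex.norm_real, Real.norm_of_nonneg hti] at h2
    have htpos : 0 < t := lt_of_le_of_ne (norm_nonneg _) (Ne.symm h0)
    rw [inv_mul_le_iff₀ htpos] at h2
    rw [mul_comm]
    exact h2

theorem norm_universalRep_le (a : A) {C : ℝ} (hC : 0 ≤ C)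
    (h : ∀ (ψ : State A) (x : GNS ψ), ‖gnsOp ψ a x‖ ≤ C * ‖x‖) : ‖universalRep A a‖ ≤ C := by
  refine ContinuousLinearMap.opNorm_le_bound _ hC fun x => ?_
  refine lp.norm_le_of_forall_sum_le (by norm_num) (by positivity) fun s => ?_
  rw [Real.mul_rpow hC (by positivity)]
  refine le_trans (Finset.sum_le_sum fun ψ _ => Real.rpow_le_rpow (by positivity)
    (h ψ (x ψ)) (by positivity)) ?_
  simp only [Real.mul_rpow hC (norm_nonneg _)]
  rw [← Finset.mul_sum]
  exact mul_le_mul_of_nonneg_left (lp.sum_rpow_le_norm_rpow (by norm_num) x s) (by positivity)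

theorem norm_gnsOp_le_norm_universalRep (ψ : State A) (a : A) :
    ‖gnsOp ψ a‖ ≤ ‖universalRep A a‖ := by
  classical
  refine ContinuousLinearMap.opNorm_le_bound _ (norm_nonneg _) fun x => ?_
  set y : UniversalSpace A := lp.single 2 ψ x with hy
  have h1 := (universalRep A a).le_opNorm y
  have h2 : ‖(universalRep A a y) ψ‖ ≤ ‖universalRep A a y‖ :=
    lp.norm_apply_le_norm two_ne_zero _ ψ
  have h3 : (universalRep A a y) ψ = gnsOp ψ a x := by
    refine (universalOp_apply a y ψ).trans ?_
    rw [hy, lp.single_apply_self]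
    rfl
  have h4 : ‖y‖ = ‖x‖ := lp.norm_single (by norm_num) ψ x
  rw [h3] at h2
  rw [h4] at h1
  exact h2.trans h1

theorem norm_universalRep_eq_gnSeminorm (a : A) : ‖universalRep A a‖ = gnSeminorm a :=
  le_antisymm (norm_universalRep_le a (gnSeminorm_nonneg a) fun ψ => norm_gnsOp_apply_le ψ a)
    (Real.iSup_le (fun ψ => (sqrt_state_le_norm_gnsOp ψ a).trans
      (norm_gnsOp_le_norm_universalRep ψ a)) (norm_nonneg _))

end Representations

end BanachStar

namespace BanachStar

open Filter Topology Polynomial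
open scoped ComplexOrder InnerProductSpace

set_option linter.unusedSectionVars false

/-! ### Passage to the unitization, and the implications of the theorem. -/

section UnitizationL1

variable {A : Type*} [NonUnitalNormedRing A] [NormedSpace ℂ A] [IsScalarTower ℂ A A]
  [SMulCommClass ℂ A A] [StarRing A] [StarModule ℂ A]

variable (A) in
/-- The unitization with the norm `‖(z, a)‖ = ‖z‖ + ‖a‖`. -/
abbrev UnitizationL1 : Type _ := WithLp 1 (Unitization ℂ A)

noncomputable instance : StarRing (UnitizationL1 A) where
  star x := WithLp.toLp 1 (star (WithLp.ofLp x))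
  star_involutive x := by
    change WithLp.toLp 1 (star (star (WithLp.ofLp x))) = x
    rw [star_star]
  star_mul x y := congrArg (WithLp.toLp 1) (star_mul (WithLp.ofLp x) (WithLp.ofLp y))
  star_add x y := congrArg (WithLp.toLp 1) (star_add (WithLp.ofLp x) (WithLp.ofLp y))

instance : StarModule ℂ (UnitizationL1 A) where
  star_smul c x := congrArg (WithLp.toLp 1) (star_smul c (WithLp.ofLp x))

instance : Nontrivial (UnitizationL1 A) :=
  (WithLp.equiv 1 (Unitization ℂ A)).nontrivial

variable (A) in
/-- The embedding of `A` into its unitization. -/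
noncomputable def inrL1 : A →ₗ[ℂ] UnitizationL1 A where
  toFun a := WithLp.toLp 1 (a : Unitization ℂ A)
  map_add' a b := congrArg (WithLp.toLp 1) (Unitization.inr_add ℂ a b)
  map_smul' c a := congrArg (WithLp.toLp 1) (Unitization.inr_smul ℂ c a)

theorem inrL1_mul (a b : A) : inrL1 A (a * b) = inrL1 A a * inrL1 A b :=
  congrArg (WithLp.toLp 1) (Unitization.inr_mul ℂ a b)

theorem inrL1_star (a : A) : inrL1 A (star a) = star (inrL1 A a) :=
  congrArg (WithLp.toLp 1) (Unitization.inr_star a)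

theorem norm_inrL1 (a : A) : ‖inrL1 A a‖ = ‖a‖ :=
  WithLp.unitization_norm_inr a

theorem norm_one_unitizationL1 : ‖(1 : UnitizationL1 A)‖ = 1 := by
  rw [WithLp.unitization_norm_def]
  change ‖(1 : Unitization ℂ A).fst‖ + ‖(1 : Unitization ℂ A).snd‖ = 1
  simp

theorem isSelfAdjoint_inrL1 {a : A} (ha : IsSelfAdjoint a) : IsSelfAdjoint (inrL1 A a) := by
  rw [IsSelfAdjoint, ← inrL1_star, ha.star_eq]

theorem spectrum_toLp (x : Unitization ℂ A) :
    spectrum ℂ (WithLp.toLp 1 x : UnitizationL1 A) = spectrum ℂ x :=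
  (AlgEquiv.spectrum_eq (WithLp.unitizationAlgEquiv ℂ : UnitizationL1 A ≃ₐ[ℂ] Unitization ℂ A)
    (WithLp.toLp 1 x)).symm

theorem spectrum_inrL1 (a : A) :
    spectrum ℂ (inrL1 A a) = spectrum ℂ (a : Unitization ℂ A) :=
  spectrum_toLp _

theorem inrL1_powSucc (a : A) (n : ℕ) : inrL1 A (powSucc a n) = inrL1 A a ^ (n + 1) := by
  induction n with
  | zero => simp [powSucc]
  | succ n ih => rw [powSucc, inrL1_mul, ih, pow_succ _ (n + 1)]

theorem bddBelow_norm_powSucc (a : A) :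
    BddBelow (Set.range fun n : ℕ => ‖powSucc a n‖ ^ (1 / ((n : ℝ) + 1))) :=
  ⟨0, by rintro _ ⟨n, rfl⟩; positivity⟩

theorem rLambda_nonneg (a : A) : 0 ≤ rLambda a :=
  Real.iInf_nonneg fun _ => by positivity

/-! ### The spectrum in the unitization -/

/-- When `A` has a unit `e`, the map `(w, x) ↦ (w, w e + x)` identifies the unitization with `ℂ ×
A`, and `z - a` corresponds to `(z, z e - a)`. Thus adjoining a further unit affects the spectrum
only at `0`, which is harmless for real spectra. -/
theorem isUnit_algebraMap_sub_inr_iff {e : A} (he : IsUnitElement e) (a : A) {z : ℂ}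
    (hz : z ≠ 0) : IsUnit (algebraMap ℂ (Unitization ℂ A) z - (a : Unitization ℂ A)) ↔
      ∃ b : A, (z • e - a) * b = e ∧ b * (z • e - a) = e := by
  have he1 : ∀ x : A, e * x = x := fun x => (he.2 x).1
  have he2 : ∀ x : A, x * e = x := fun x => (he.2 x).2
  constructor
  · intro h
    obtain ⟨v, hv1, hv2⟩ := isUnit_iff_exists.1 h
    have f1 : z * v.fst = 1 := by
      have := congrArg (fun y : Unitization ℂ A => y.fst) hv1
      simpa [Unitization.algebraMap_eq_inl, sub_eq_add_neg] using this
    have s1 : z • v.snd - v.fst • a - a * v.snd = 0 := by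
      have := congrArg (fun y : Unitization ℂ A => y.snd) hv1
      simp only [Unitization.algebraMap_eq_inl, sub_eq_add_neg] at this
      simp at this
      rw [← this]
      abel
    have s2 : z • v.snd - v.fst • a - v.snd * a = 0 := by
      have := congrArg (fun y : Unitization ℂ A => y.snd) hv2
      simp only [Unitization.algebraMap_eq_inl, sub_eq_add_neg] at this
      simp at this
      rw [← this]
      abel
    refine ⟨v.fst • e + v.snd, ?_, ?_⟩
    · have : (z • e - a) * (v.fst • e + v.snd) =
          (z * v.fst) • e + (z • v.snd - v.fst • a - a * v.snd) := by
        simp only [sub_mul, mul_add, smul_mul_assoc, mul_smul_comm, he1, he2]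
        module
      rw [this, s1, f1, one_smul, add_zero]
    · have : (v.fst • e + v.snd) * (z • e - a) =
          (z * v.fst) • e + (z • v.snd - v.fst • a - v.snd * a) := by
        simp only [mul_sub, add_mul, smul_mul_assoc, mul_smul_comm, he1, he2]
        module
      rw [this, s2, f1, one_smul, add_zero]
  · rintro ⟨b, h1, h2⟩
    simp only [sub_mul, mul_sub, smul_mul_assoc, mul_smul_comm, he1, he2] at h1 h2
    obtain ⟨d, hd⟩ : ∃ d : A, d = b - z⁻¹ • e := ⟨_, rfl⟩
    have hd1 : z • d - z⁻¹ • a - a * d = 0 := by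
      simp only [hd, mul_sub, smul_sub, mul_smul_comm, he2, smul_inv_smul₀ hz]
      rw [← sub_eq_zero.2 h1]
      abel
    have hd2 : z • d - z⁻¹ • a - d * a = 0 := by
      simp only [hd, sub_mul, smul_sub, smul_mul_assoc, he1, smul_inv_smul₀ hz]
      rw [← sub_eq_zero.2 h2]
      abel
    refine isUnit_iff_exists.2 ⟨Unitization.inl z⁻¹ + (d : Unitization ℂ A), ?_, ?_⟩
    · ext
      · simp [Unitization.algebraMap_eq_inl, sub_eq_add_neg, hz]
      · simp only [Unitization.algebraMap_eq_inl, sub_eq_add_neg]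
        simp
        rw [← hd1]
        abel
    · ext
      · simp [Unitization.algebraMap_eq_inl, sub_eq_add_neg, hz]
      · simp only [Unitization.algebraMap_eq_inl, sub_eq_add_neg]
        simp
        rw [← hd2]
        abel

theorem mem_sp_iff (a : A) {z : ℂ} (hz : z ≠ 0) :
    z ∈ sp a ↔ z ∈ spectrum ℂ (a : Unitization ℂ A) := by
  by_cases h : ∃ e : A, IsUnitElement e
  · have hiff : ∀ e : A, IsUnitElement e →
        ((¬ ∃ b : A, (z • e - a) * b = e ∧ b * (z • e - a) = e) ↔
          z ∈ spectrum ℂ (a : Unitization ℂ A)) := fun e he => by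
      rw [spectrum.mem_iff, isUnit_algebraMap_sub_inr_iff he a hz]
    constructor
    · rintro (⟨e, he, hn⟩ | ⟨hn, -⟩)
      · exact (hiff e he).1 hn
      · exact absurd h hn
    · obtain ⟨e, he⟩ := h
      exact fun hs => Or.inl ⟨e, he, (hiff e he).2 hs⟩
  · exact ⟨fun hs => hs.elim (fun ⟨e, he, _⟩ => absurd ⟨e, he⟩ h) And.right,
      fun hs => Or.inr ⟨h, hs⟩⟩

theorem isHermitianAlgebra_iff : IsHermitianAlgebra A ↔
    ∀ a : A, IsSelfAdjoint a → ∀ z ∈ spectrum ℂ (a : Unitization ℂ A), z.im = 0 := by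
  refine forall₂_congr fun a _ => forall_congr' fun z => ?_
  by_cases hz : z = 0
  · simp [hz]
  · rw [mem_sp_iff a hz]

/-- A self-adjoint element of the unitization is a real scalar plus a self-adjoint element of `A`.
-/
theorem IsHermitianAlgebra.hasRealSpectra (hA : IsHermitianAlgebra A) :
    HasRealSpectra (UnitizationL1 A) := by
  intro h hh z hz
  obtain ⟨x⟩ := h
  have hx : star x = x := congrArg WithLp.ofLp hh
  have hfst : star x.fst = x.fst := congrArg (fun y : Unitization ℂ A => y.fst) hx
  have hsnd : IsSelfAdjoint x.snd := congrArg (fun y : Unitization ℂ A => y.snd) hx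
  rw [spectrum_toLp, ← Unitization.inl_fst_add_inr_snd_eq x, ← Unitization.algebraMap_eq_inl,
    add_comm _ (x.snd : Unitization ℂ A),
    ← spectrum.add_singleton_eq] at hz
  obtain ⟨w, hw, _, rfl, he⟩ := hz
  have h1 := isHermitianAlgebra_iff.1 hA _ hsnd _ hw
  have h2 : x.fst.im = 0 := Complex.conj_eq_iff_im.1 hfst
  rw [← he]
  simp [h1, h2]

variable [CompleteSpace A]

theorem norm_le_rLambda {a : A} {z : ℂ} (hz : z ∈ spectrum ℂ (a : Unitization ℂ A)) :
    ‖z‖ ≤ rLambda a := by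
  refine le_ciInf fun n => ?_
  rw [← spectrum_inrL1] at hz
  have h1 := spectrum.norm_le_norm_mul_of_mem (spectrum.pow_mem_pow _ (n + 1) hz)
  rw [norm_one_unitizationL1, mul_one, ← inrL1_powSucc, norm_inrL1, norm_pow] at h1
  have hn : (0 : ℝ) < (n : ℝ) + 1 := by positivity
  rw [one_div, Real.le_rpow_inv_iff_of_pos (norm_nonneg _) (norm_nonneg _) hn]
  exact_mod_cast h1

/-- Gelfand's formula: the infimum is below every term of a sequence converging to the spectral
radius. The index is shifted by one, since `powSucc a n` is the power `n + 1`. -/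
theorem rLambda_le {a : A} {R : ℝ} (hR : ∀ z ∈ spectrum ℂ (a : Unitization ℂ A), ‖z‖ ≤ R) :
    rLambda a ≤ R := by
  rw [← spectrum_inrL1] at hR
  obtain ⟨w, hw⟩ := spectrum.nonempty (inrL1 A a)
  have hR0 : 0 ≤ R := (norm_nonneg w).trans (hR w hw)
  have hsr : spectralRadius ℂ (inrL1 A a) ≤ ENNReal.ofReal R := iSup₂_le fun z hz => by
    rw [← enorm_eq_nnnorm, ← ofReal_norm]
    exact ENNReal.ofReal_le_ofReal (hR z hz)
  have hlim := (spectrum.pow_norm_pow_one_div_tendsto_nhds_spectralRadius (inrL1 A a)).comp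
    (tendsto_add_atTop_nat 1)
  have hle : ENNReal.ofReal (rLambda a) ≤ spectralRadius ℂ (inrL1 A a) :=
    ge_of_tendsto' hlim fun n => by
      simp only [Function.comp_apply]
      refine ENNReal.ofReal_le_ofReal ?_
      rw [← inrL1_powSucc, norm_inrL1]
      have := ciInf_le (bddBelow_norm_powSucc a) n
      push_cast
      exact this
  exact (ENNReal.ofReal_le_ofReal_iff hR0).1 (hle.trans hsr)

/-! ### Representations and the spectrum -/

theorem norm_le_of_isSelfAdjoint {D : Type*} [CStarAlgebra D] {T : D} (hT : IsSelfAdjoint T)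
    {R : ℝ} (hR0 : 0 ≤ R) (hR : ∀ z ∈ spectrum ℂ T, ‖z‖ ≤ R) : ‖T‖ ≤ R := by
  have h1 := hT.spectralRadius_eq_nnnorm
  have h2 : spectralRadius ℂ T ≤ ENNReal.ofReal R := iSup₂_le fun z hz => by
    rw [← enorm_eq_nnnorm, ← ofReal_norm]
    exact ENNReal.ofReal_le_ofReal (hR z hz)
  rw [h1, ← enorm_eq_nnnorm, ← ofReal_norm] at h2
  exact (ENNReal.ofReal_le_ofReal_iff hR0).1 h2

variable (A) in
/-- The unital extension of the universal representation to the unitization. -/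
noncomputable def universalRepUnitization :
    Unitization ℂ A →ₐ[ℂ] (UniversalSpace A →L[ℂ] UniversalSpace A) :=
  Unitization.lift (universalRep A).toNonUnitalAlgHom

theorem universalRepUnitization_inr (a : A) :
    universalRepUnitization A (a : Unitization ℂ A) = universalRep A a := by
  simp [universalRepUnitization]

/-- In a C*-algebra the norm of a self-adjoint element is its spectral radius, and the unital
extension of `π_u` shrinks spectra. -/
theorem norm_universalRep_le_rLambda {h : A} (hh : IsSelfAdjoint h) :
    ‖universalRep A h‖ ≤ rLambda h := by
  refine norm_le_of_isSelfAdjoint (hh.map (universalRep A)) (rLambda_nonneg h) fun z hz => ?_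
  refine norm_le_rLambda (AlgHom.spectrum_apply_subset
    (universalRepUnitization A) (h : Unitization ℂ A) ?_)
  rwa [universalRepUnitization_inr]

theorem norm_universalRep_le_rSigma (a : A) : ‖universalRep A a‖ ≤ rSigma a := by
  refine Real.le_sqrt_of_sq_le ?_
  rw [sq, ← CStarRing.norm_star_mul_self, ← map_star, ← map_mul]
  exact norm_universalRep_le_rLambda (IsSelfAdjoint.star_mul_self a)

/-! ### States of Hermitian algebras -/

/-- The variance `φ((x - φ(x))* (x - φ(x))) = φ(x* x) - |φ(x)|²` is nonnegative. -/
theorem norm_sq_le_of_isPositiveFunctional {φ : UnitizationL1 A →ₗ[ℂ] ℂ}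
    (hφ : IsPositiveFunctional φ) (h1 : φ 1 = 1) (x : UnitizationL1 A) :
    ‖φ x‖ ^ 2 ≤ (φ (star x * x)).re := by
  have hstar : φ (star x) = starRingEnd ℂ (φ x) := by
    have := hφ.star_mul_conj x 1
    rw [star_one, one_mul, mul_one] at this
    exact this.symm
  have h2 := hφ.re_nonneg (x - φ x • 1)
  have h3 : star (x - φ x • 1) * (x - φ x • 1) =
      star x * x - φ x • star x - star (φ x) • x + (star (φ x) * φ x) • 1 := by
    rw [star_sub, star_smul, star_one]
    simp only [sub_mul, mul_sub, smul_mul_assoc, mul_smul_comm, one_mul, mul_one, smul_sub, smul_smul]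
    rw [mul_comm (φ x)]
    abel
  rw [h3] at h2
  simp only [map_add, map_sub, map_smul, smul_eq_mul, h1, hstar, mul_one, Complex.star_def] at h2
  have h4 : φ x * starRingEnd ℂ (φ x) = ((‖φ x‖ ^ 2 : ℝ) : ℂ) := by
    rw [Complex.mul_conj, Complex.normSq_eq_norm_sq]
  rw [mul_comm (starRingEnd ℂ (φ x)), h4] at h2
  simp only [Complex.add_re, Complex.sub_re, Complex.ofReal_re] at h2
  linarith

/-- In a Hermitian algebra the value `r_λ(a* a) ≠ 0` is attained by a state. -/
theorem IsHermitianAlgebra.exists_state (hA : IsHermitianAlgebra A) {a : A}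
    (ha : 0 < rLambda (star a * a)) :
    ∃ ψ : State A, (ψ.1 (star a * a)).re = rLambda (star a * a) := by
  have hsa := IsSelfAdjoint.star_mul_self a
  have hne : star (inrL1 A a) * inrL1 A a ≠ 0 := fun h0 => by
    rw [← inrL1_star, ← inrL1_mul] at h0
    refine ha.not_ge (rLambda_le fun z hz => ?_)
    rw [← spectrum_inrL1, h0, spectrum.zero_eq] at hz
    simp [Set.mem_singleton_iff.1 hz]
  obtain ⟨φ, hpos, h1, hbd, hatt⟩ := hA.hasRealSpectra.exists_positiveFunctional (inrL1 A a) hne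
  rw [← inrL1_star, ← inrL1_mul] at hatt
  have hbd' : ∀ h : A, IsSelfAdjoint h → ‖φ (inrL1 A h)‖ ≤ rLambda h := fun h hh =>
    hbd _ _ (isSelfAdjoint_inrL1 hh) fun z hz => norm_le_rLambda (by rwa [← spectrum_inrL1])
  have hval : (φ (inrL1 A (star a * a))).re = rLambda (star a * a) :=
    le_antisymm ((Complex.re_le_norm _).trans (hbd' _ hsa))
      (rLambda_le fun z hz => hatt z (by rwa [spectrum_inrL1]))
  set ψ : A →ₗ[ℂ] ℂ := φ ∘ₗ inrL1 A with hψ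
  have hψa : ∀ x, ψ x = φ (inrL1 A x) := fun x => rfl
  have hmem : (1 : ℝ) ∈ variationBounds ψ := ⟨zero_le_one, fun x => by
    rw [hψa, hψa, one_mul, inrL1_mul, inrL1_star]
    exact norm_sq_le_of_isPositiveFunctional hpos h1 _⟩
  refine ⟨⟨ψ, ⟨fun b => ?_, fun b => ?_, ⟨1, hmem⟩,
    isLeast_variationBounds_of_sInf_eq_one hmem fun v hv => ?_⟩⟩, hval⟩
  · rw [hψa, inrL1_mul, inrL1_star]
    exact hpos _
  -- On self-adjoint elements `φ` is bounded by `r_λ`, hence by the norm, which is the term `n = 0`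
  -- of the infimum.
  · refine (LipschitzOnWith.of_dist_le_mul (K := ‖star b‖₊ * ‖b‖₊) fun x hx y hy => ?_).continuousOn
    have hs : IsSelfAdjoint (star b * (x - y) * b) := by
      rw [IsSelfAdjoint, star_mul, star_mul, star_star, star_sub, hx.star_eq, hy.star_eq, mul_assoc]
    rw [dist_eq_norm, dist_eq_norm, ← map_sub, ← sub_mul, ← mul_sub]
    refine (hbd' _ hs).trans (ciInf_le_of_le (bddBelow_norm_powSucc _) 0 ?_)
    simp only [powSucc, Nat.cast_zero, zero_add, div_one, Real.rpow_one, NNReal.coe_mul,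
      coe_nnnorm]
    calc _ ≤ ‖star b‖ * ‖x - y‖ * ‖b‖ := (norm_mul_le _ _).trans (by gcongr; exact norm_mul_le _ _)
      _ = _ := by ring
  -- The variation cannot drop below `1` on restriction to `A`: testing on `h = a* a` gives `r² ≤
  -- |ψ(h)|² ≤ v ψ(h²) ≤ v r²` with `r > 0`.
  · set r := rLambda (star a * a) with hr
    have h2 := hv.2 (star a * a)
    have h3 : r ≤ ‖ψ (star a * a)‖ := hval.symm.le.trans (Complex.re_le_norm _)
    have h4 : (ψ (star (star a * a) * (star a * a))).re ≤ r ^ 2 := by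
      refine (Complex.re_le_norm _).trans ?_
      refine hbd _ _ (isSelfAdjoint_inrL1 (IsSelfAdjoint.star_mul_self _)) fun z hz => ?_
      rw [hsa.star_eq, inrL1_mul, ← sq, spectrum.map_pow] at hz
      obtain ⟨w, hw, rfl⟩ := hz
      rw [spectrum_inrL1] at hw
      simp only [norm_pow]
      gcongr
      exact norm_le_rLambda hw
    have h5 : r ^ 2 ≤ v * r ^ 2 := by
      calc r ^ 2 ≤ ‖ψ (star a * a)‖ ^ 2 := by gcongr
        _ ≤ _ := h2
        _ ≤ v * r ^ 2 := by gcongr; exact hv.1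
    exact (le_mul_iff_one_le_left (by positivity)).1 h5

theorem IsHermitianAlgebra.gnSeminorm_eq_rSigma (hA : IsHermitianAlgebra A) (a : A) :
    gnSeminorm a = rSigma a := by
  refine le_antisymm ?_ ?_
  · rw [← norm_universalRep_eq_gnSeminorm]
    exact norm_universalRep_le_rSigma a
  · rcases (rLambda_nonneg (star a * a)).eq_or_lt with h0 | hpos
    · rw [rSigma, ← h0, Real.sqrt_zero]
      exact gnSeminorm_nonneg a
    · obtain ⟨ψ, hψ⟩ := hA.exists_state hpos
      rw [rSigma, ← hψ]
      exact le_ciSup (bddAbove_sqrt_state a) ψ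

/-! ### The converse -/

/-- For self-adjoint `x`, (ii) reads `‖π_u(x)‖² = r_λ(x²)`, and `z²` lies in the spectrum of `x²`.
-/
theorem norm_le_norm_universalRep (hA : ∀ a : A, ‖universalRep A a‖ = rSigma a) {x : A}
    (hx : IsSelfAdjoint x) {z : ℂ} (hz : z ∈ spectrum ℂ (x : Unitization ℂ A)) :
    ‖z‖ ≤ ‖universalRep A x‖ := by
  rw [hA, rSigma, hx.star_eq]
  refine Real.le_sqrt_of_sq_le ?_
  rw [← norm_pow]
  refine norm_le_rLambda ?_
  rw [Unitization.inr_mul, ← sq]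
  exact spectrum.pow_mem_pow _ 2 hz

/-- The element `k (1 - c k ^ 2) ^ m`. -/
def dampedPow (c : ℝ) (k : A) : ℕ → A
  | 0 => k
  | m + 1 => dampedPow c k m - (c : ℂ) • (dampedPow c k m * (k * k))

theorem inr_dampedPow (c : ℝ) (k : A) (m : ℕ) : ((dampedPow c k m : A) : Unitization ℂ A) =
    aeval (k : Unitization ℂ A) ((X : ℂ[X]) * (1 - C (c : ℂ) * X ^ 2) ^ m) := by
  induction m with
  | zero => simp [dampedPow]
  | succ m ih =>
    rw [dampedPow, Unitization.inr_sub, Unitization.inr_smul, Unitization.inr_mul, ih,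
      pow_succ (1 - C (c : ℂ) * X ^ 2), ← mul_assoc, map_mul _ (X * (1 - C (c : ℂ) * X ^ 2) ^ m), Unitization.inr_mul]
    simp only [map_sub, map_mul, map_one, map_pow, aeval_C, aeval_X, mul_sub, mul_one, sq]
    rw [← Algebra.smul_def, mul_smul_comm]

theorem isSelfAdjoint_dampedPow (c : ℝ) {k : A} (hk : IsSelfAdjoint k) (m : ℕ) :
    IsSelfAdjoint (dampedPow c k m) ∧ Commute (dampedPow c k m) k := by
  induction m with
  | zero => exact ⟨hk, Commute.refl k⟩
  | succ m ih =>
    have hc : Commute (dampedPow c k m) (k * k) := ih.2.mul_right ih.2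
    constructor
    · rw [IsSelfAdjoint, dampedPow, star_sub, star_smul, star_mul, star_mul, hk.star_eq,
        ih.1.star_eq, hc.eq]
      simp
    · exact ih.2.sub_left ((ih.2.mul_left ((Commute.refl k).mul_left (Commute.refl k))).smul_left _)

/-- The spectrum of `π_u(k)` lies in `[-R, R]`, where `0 ≤ 1 - w² / R² ≤ 1`; so the damping factor
never increases the bound `R`, whatever `m` is. -/
theorem norm_universalRep_dampedPow_le {k : A} (hk : IsSelfAdjoint k) {R : ℝ} (hR0 : 0 < R)
    (hR : ‖universalRep A k‖ ≤ R) (m : ℕ) :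
    ‖universalRep A (dampedPow (R ^ 2)⁻¹ k m)‖ ≤ R := by
  refine norm_le_of_isSelfAdjoint ((isSelfAdjoint_dampedPow _ hk m).1.map (universalRep A)) hR0.le
    fun z hz => ?_
  have hT : IsSelfAdjoint (universalRep A k) := hk.map (universalRep A)
  -- If `S(A)` is empty, the operator algebra is zero and spectra in it are empty.
  rcases subsingleton_or_nontrivial (UniversalSpace A →L[ℂ] UniversalSpace A) with hs | hn
  · rw [spectrum.of_subsingleton] at hz
    exact absurd hz (Set.notMem_empty z)
  rw [← universalRepUnitization_inr, inr_dampedPow, ← aeval_algHom_apply,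
    universalRepUnitization_inr, spectrum.map_polynomial_aeval] at hz
  obtain ⟨w, hw, rfl⟩ := hz
  have hwr : w = (w.re : ℂ) := hT.mem_spectrum_eq_re hw
  have hwR : ‖w‖ ≤ R := (spectrum.norm_le_norm_of_mem hw).trans hR
  rw [hwr, Complex.norm_real, Real.norm_eq_abs] at hwR
  have hev : eval w ((X : ℂ[X]) * (1 - C (((R ^ 2)⁻¹ : ℝ) : ℂ) * X ^ 2) ^ m) =
      ((w.re * (1 - (R ^ 2)⁻¹ * w.re ^ 2) ^ m : ℝ) : ℂ) := by
    conv_lhs => rw [hwr]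
    simp
  have hsq : w.re ^ 2 ≤ R ^ 2 := by
    rw [← sq_abs]; gcongr
  have h1 : (R ^ 2)⁻¹ * w.re ^ 2 ≤ 1 := by
    rw [inv_mul_le_iff₀ (by positivity)]; linarith
  have h0 : 0 ≤ (R ^ 2)⁻¹ * w.re ^ 2 := by positivity
  simp only [hev]
  rw [Complex.norm_real, Real.norm_eq_abs, abs_mul, abs_pow, abs_of_nonneg (by linarith :
    0 ≤ 1 - (R ^ 2)⁻¹ * w.re ^ 2)]
  calc _ ≤ R * 1 := by
        gcongr
        exact pow_le_one₀ (by linarith) (by linarith)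
    _ = R := mul_one R

/-- At `i` the damping factor becomes `1 + R⁻² > 1`, so its powers outgrow the uniform bound `R`. -/
theorem I_notMem_spectrum (hA : ∀ a : A, ‖universalRep A a‖ = rSigma a) {k : A}
    (hk : IsSelfAdjoint k) : Complex.I ∉ spectrum ℂ (k : Unitization ℂ A) := by
  intro hI
  set R : ℝ := ‖universalRep A k‖ + 1 with hR
  have hR0 : 0 < R := by positivity
  have hbound : ∀ m : ℕ, (1 + (R ^ 2)⁻¹) ^ m ≤ R := fun m => by
    have h1 := spectrum.subset_polynomial_aeval (k : Unitization ℂ A)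
      ((X : ℂ[X]) * (1 - C (((R ^ 2)⁻¹ : ℝ) : ℂ) * X ^ 2) ^ m) ⟨_, hI, rfl⟩
    rw [← inr_dampedPow] at h1
    have h2 := (norm_le_norm_universalRep hA (isSelfAdjoint_dampedPow _ hk m).1 h1).trans
      (norm_universalRep_dampedPow_le hk hR0 (by linarith) m)
    have h3 : eval Complex.I ((X : ℂ[X]) * (1 - C (((R ^ 2)⁻¹ : ℝ) : ℂ) * X ^ 2) ^ m) =
        Complex.I * (((1 + (R ^ 2)⁻¹) ^ m : ℝ) : ℂ) := by
      simp
    simp only [h3] at h2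
    rwa [norm_mul, Complex.norm_I, one_mul, Complex.norm_real,
      Real.norm_of_nonneg (by positivity)] at h2
  have hlim := tendsto_pow_atTop_atTop_of_one_lt
    (lt_add_of_pos_right 1 (by positivity : 0 < (R ^ 2)⁻¹))
  obtain ⟨m, hm⟩ := (hlim.eventually_gt_atTop R).exists
  exact (hbound m).not_gt hm

/-- A real quadratic polynomial carries a non-real `z` to `i`. Having no constant term, it keeps the
element in `A`, and real coefficients keep it self-adjoint. -/
theorem isHermitianAlgebra_of_norm_universalRep
    (hA : ∀ a : A, ‖universalRep A a‖ = rSigma a) : IsHermitianAlgebra A := by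
  refine isHermitianAlgebra_iff.2 fun h hh z hz => ?_
  by_contra him
  have hn : 0 < Complex.normSq z := Complex.normSq_pos.2 fun h0 => him (by simp [h0])
  -- real coefficients with `s z + t z ^ 2 = i`
  set t : ℝ := z.re / (z.im * Complex.normSq z) with ht
  set s : ℝ := (z.im ^ 2 - z.re ^ 2) / (z.im * Complex.normSq z) with hs
  have hst : (s : ℂ) * z + (t : ℂ) * z ^ 2 = Complex.I := by
    have hns : Complex.normSq z = z.re ^ 2 + z.im ^ 2 := by rw [Complex.normSq_apply]; ring
    have hne : z.re ^ 2 + z.im ^ 2 ≠ 0 := by rw [← hns]; exact hn.ne'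
    have h1 : s * z.re + t * (z.re ^ 2 - z.im ^ 2) = 0 := by
      rw [hs, ht, hns]; field_simp; ring
    have h2 : s * z.im + t * (2 * z.re * z.im) = 1 := by
      rw [hs, ht, hns]; field_simp; ring
    clear_value s t
    apply Complex.ext
    · rw [Complex.add_re, Complex.re_ofReal_mul, Complex.re_ofReal_mul, sq, Complex.mul_re,
        Complex.I_re, ← h1]
      ring
    · rw [Complex.add_im, Complex.im_ofReal_mul, Complex.im_ofReal_mul, sq, Complex.mul_im,
        Complex.I_im, ← h2]
      ring
  have hsa : IsSelfAdjoint ((s : ℂ) • h + (t : ℂ) • (h * h)) := by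
    rw [IsSelfAdjoint, star_add, star_smul, star_smul, star_mul, hh.star_eq]
    simp
  refine I_notMem_spectrum hA hsa ?_
  have := spectrum.subset_polynomial_aeval (h : Unitization ℂ A)
    (C (s : ℂ) * X + C (t : ℂ) * X ^ 2) ⟨z, hz, rfl⟩
  simp only [eval_add, eval_mul, eval_C, eval_X, eval_pow, hst] at this
  convert this using 1
  simp only [map_add, map_mul, aeval_C, aeval_X, ← Algebra.smul_def, sq,
    Unitization.inr_add, Unitization.inr_smul, Unitization.inr_mul]

end UnitizationL1

end BanachStar

theorem mainTheorem3 {A : Type*} [NonUnitalNormedRing A] [NormedSpace ℂ A] [IsScalarTower ℂ A A]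
    [SMulCommClass ℂ A A] [StarRing A] [StarModule ℂ A] [CompleteSpace A] :
    List.TFAE
      [BanachStar.IsHermitianAlgebra A,
        ∀ a : A, ‖BanachStar.universalRep A a‖ = BanachStar.rSigma a,
        ∀ a : A, BanachStar.gnSeminorm a = BanachStar.rSigma a] := by
  tfae_have 1 → 3 := BanachStar.IsHermitianAlgebra.gnSeminorm_eq_rSigma
  tfae_have 3 → 2 := fun h a => (BanachStar.norm_universalRep_eq_gnSeminorm a).trans (h a)
  tfae_have 2 → 1 := BanachStar.isHermitianAlgebra_of_norm_universalRep
  tfae_finish
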